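/- **Setting.** Fix a linearly ordered non-empty set of constants. A *database instance* $\Delta$ consists of finitely many tables, each with a name, a degree $n$ and a finite multiset of $n$-tuples of constants; it is identified with the multiset of facts $T(t)$. All unions of collections of rules or tuples are multiset unions. *SQL (no NULLs; attributes given by position, subqueries uncorrelated).* Statements are $Q ::= $ `SELECT` $c_1,\dots,c_n$ (no `FROM`) $\mid$ `SELECT` $e_1,\dots,e_n$ `FROM` $R$ `WHERE` $C$ $\mid$ $Q_1$ `UNION ALL` $Q_2$ $\mid$ `WITH` $r_1$ `AS` $Q_1,\dots,r_m$ `AS` $Q_m$ $Q$, where each $c_i$ is a constant and each $e_i$ an attribute or a constant; relations are $R ::= $ a table or view name $\mid (Q) \mid R_1$ `JOIN` $R_2$ `ON` $C$; conditions are $C ::= $ true $\mid$ comparisons ($=,\neq,<,\le,>,\ge$) of attributes or constants $\mid (e_1,\dots,e_k)$ `[NOT] IN` $R$ $\mid$ `EXISTS` $R$ $\mid C$ `AND` $C \mid C$ `OR` $C \mid$ `NOT` $C$. The statement $Q$ is *well-formed* over $\Delta$ if degrees fit, attributes exist, and each relation name is visible where it is used: tables are visible everywhere, and the views $r_1,\dots,r_m$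 of a `WITH` clause only in its main statement $Q$; moreover, for each `WITH` clause, $r_1,\dots,r_m$ are pairwise distinct, no $r_i$ is already visible or is declared again inside any $Q_j$ or inside $Q$, and no view name is declared both inside some $Q_j$ and inside $Q$. The computed answer is the usual multiset one (projection without duplicate elimination, selection, product, multiset union; a `WITH` statement evaluates $Q$ with each $r_i$ interpreted as the answer of $Q_i$). A *correct* SQL implementation is a function $\mathrm{ans}$ such that $\mathrm{ans}_\Delta(Q)$ is the computed answer for all $\Delta$ and all well-formed $Q$. *Hypothetical Datalog.* Rules are $A\leftarrow G_1\wedge\dots\wedge G_n$ ($n\ge 0$) and goals are $G ::= A \mid \neg G \mid R_1\wedge\dots\wedge R_n\Rightarrow G$, with $A$ a function-free atom (in goals also a built-in comparison) and the $R_i$ rules, each with its own variables. A database is a finite multiset of rules. A *stratification* of a database maps predicates to $\mathbb N$ so that in each rule, including the rules in antecedents of embedded implications at any depth, no body goal has a higher level than the head predicate; the level of $R_1\wedge\dots\wedge R_n\Rightarrow G$ is that of $G$, that of $\neg G$ is one more than that of $G$, and comparisons have level $0$. For a stratified database $P$, the *unified stratified semantics* $\mathcal E$ is the set of axioms $P'\vdash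 id:\psi$ ($\psi$ a ground goal; $P'\supseteq P$ a database formed by adding rules from antecedents in $P$) obtained stratum by stratum by: applying a ground instance of a rule of $P'$; true comparisons; negation as failure for goals of lower, completed strata; and inferring $P'\vdash id: R_1\wedge\dots\wedge R_n\Rightarrow\psi$ from $P'\cup\{R_1,\dots,R_n\}\vdash id:\psi$. The label $id$ of an atom obtained from a rule consists of the occurrence of that rule (equal copies being distinguished) and the labelled instances of its body goals; true comparisons have one label, as do true negations. Let $\mathit{solve}(\phi,\mathcal E)=\{P'\vdash id:\psi\in\mathcal E : \psi=\phi\theta \text{ for some ground substitution }\theta\}$, and let $P(\mathcal A)$ be the multiset in which $\psi$ has as multiplicity the number of $id$ with $P\vdash id:\psi\in\mathcal A$. *Translation.* $\mathrm{SQL\_to\_DL}(r,Q)$ is the multiset of rules defined as follows, where $\mathrm{goalname}$, $s$ denote new predicate names, fresh each time and different from the tables, from $r$ and from the view names in $Q$. - `SELECT` $\bar c$: the fact $r(\bar c)$. - `SELECT` $\bar e$ `FROM` $R$ `WHERE` $C$: the rule $r(\bar e)\leftarrow DLRel(\bar X)\wedge DLCond$, with the additional rules for $R$ and for $C$. - $Q_1$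 `UNION ALL` $Q_2$: $\mathrm{SQL\_to\_DL}(r,Q_1)\cup \mathrm{SQL\_to\_DL}(r,Q_2)$. - `WITH` $r_1$ `AS` $Q_1,\dots,r_m$ `AS` $Q_m$ $Q$: $\{\,r(\bar X)\leftarrow (\bigwedge \mathrm{SQL\_to\_DL}(r_1,Q_1)\wedge\dots\wedge\bigwedge \mathrm{SQL\_to\_DL}(r_m,Q_m)\Rightarrow s(\bar X))\,\}\cup \mathrm{SQL\_to\_DL}(s,Q)$. - A name $R$ gives $DLRel=R$; a statement $(Q)$ gives $\mathrm{goalname}$ with the rules $\mathrm{SQL\_to\_DL}(\mathrm{goalname},Q)$; a join gives $\mathrm{goalname}$ with the rule $\mathrm{goalname}(\bar X,\bar Y)\leftarrow DLRel_1(\bar X)\wedge DLRel_2(\bar Y)\wedge DLCond$ and the additional rules of its parts. - A true condition gives no goal, a comparison the built-in goal, $\bar e$ `NOT IN` $R$ the goal $\neg DLRel(\bar e)$, $\bar e$ `IN` $R$ the goal $\neg\neg DLRel(\bar e)$, `EXISTS` $R$ the goal $\neg\neg\,\mathrm{goalname}()$ with $\mathrm{goalname}()\leftarrow DLRel(\bar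 X)$, and `AND` the conjunction of the goals of its parts. Let $\Gamma(\bar X)$ be the goals for the relation(s) to which the condition applies. Then `NOT` $C$ gives $\neg\,\mathrm{goalname}(\bar X)$ with $\mathrm{goalname}(\bar X)\leftarrow \Gamma(\bar X)\wedge DLCond$, and $C_1$ `OR` $C_2$ gives $\neg\neg\,\mathrm{goalname}(\bar X)$ with one such rule for each of $C_1$, $C_2$. The additional rules of all parts are included. **Theorem.** Let $\mathrm{ans}$ be a correct SQL implementation, $\Delta$ a database instance, $Q$ a well-formed SQL statement of degree $n$ over $\Delta$, and $r$ a name that is neither a table of $\Delta$ nor a view name declared in $Q$. For every choice of the fresh names, let $\Delta'=\Delta\cup \mathrm{SQL\_to\_DL}(r,Q)$. 1. For the unified stratified semantics $\mathcal E$ of $\Delta'$ along any stratification of $\Delta'$, the multiset of facts $\{\,r(t) : t\in \mathrm{ans}_\Delta(Q)\,\}$ equals $\Delta'(\mathit{solve}(r(X_1,\dots,X_n),\mathcal E))$. 2. If no view name is declared twice in $Q$, then $\Delta'$ has a stratification. -/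

import Mathlib

namespace HypSQL

universe u v

/-! ## Hypothetical Datalog: syntax -/

/-- Comparison operators (of SQL conditions, and of built-in Datalog atoms). -/
inductive CmpOp where
  | eq | ne | lt | le | gt | ge

/-- The meaning of a comparison operator on constants. -/
def CmpOp.Holds {Val : Type v} [LinearOrder Val] : CmpOp → Val → Val → Prop
  | .eq, a, b => a = b
  | .ne, a, b => a ≠ b
  | .lt, a, b => a < b
  | .le, a, b => a ≤ b
  | .gt, a, b => b < a
  | .ge, a, b => b ≤ a

/-- Terms are variables or constants: the logic is function-free. -/
inductive Term (Val : Type v) where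
  | var (i : ℕ)
  | const (c : Val)

/-- An atom `p(t₁, …, tₙ)`. -/
structure Atom (Name : Type u) (Val : Type v) where
  pred : Name
  args : List (Term Val)

mutual

/-- A rule `A ← G₁ ∧ … ∧ Gₙ`; a fact `A` is a rule with empty body.
Every rule is the scope of its own variables. In particular the variables of a rule in the
antecedent of an embedded implication have nothing to do with those of the enclosing rule, which
is what the syntactic disjointness conditions on variables express. -/
inductive Rule (Name : Type u) (Val : Type v) where
  | mk (head : Atom Name Val) (body : List (Goal Name Val))

/-- A goal: an atom `A` (with a user predicate, or a built-in comparison), a negation `¬ G`, or an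
embedded implication `R₁ ∧ … ∧ Rₙ ⇒ G`. -/
inductive Goal (Name : Type u) (Val : Type v) where
  | atom (A : Atom Name Val)
  | cmp (op : CmpOp) (s t : Term Val)
  | neg (G : Goal Name Val)
  | imp (Rs : List (Rule Name Val)) (G : Goal Name Val)

end

variable {Name : Type u} {Val : Type v}

def Rule.head : Rule Name Val → Atom Name Val
  | .mk A _ => A

def Rule.body : Rule Name Val → List (Goal Name Val)
  | .mk _ Gs => Gs

/-- A (hypothetical deductive) database is a multiset of rules. -/
abbrev Program (Name : Type u) (Val : Type v) := Multiset (Rule Name Val)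

/-- Ground substitution of a term. -/
def Term.subst (θ : ℕ → Val) : Term Val → Term Val
  | .var i => .const (θ i)
  | .const c => .const c

/-- Ground substitution of an atom. -/
def Atom.subst (θ : ℕ → Val) (A : Atom Name Val) : Atom Name Val :=
  ⟨A.pred, A.args.map (Term.subst θ)⟩

/-- Ground substitution of a goal. Assumed rules are not affected: they take the form that they
have in the program. -/
def Goal.subst (θ : ℕ → Val) : Goal Name Val → Goal Name Val
  | .atom A => .atom (A.subst θ)
  | .cmp op s t => .cmp op (s.subst θ) (t.subst θ)
  | .neg G => .neg (G.subst θ)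
  | .imp Rs G => .imp Rs (G.subst θ)

/-- The rules that are assumed by the embedded implications of a goal. -/
def Goal.assumed : Goal Name Val → List (Rule Name Val)
  | .atom _ => []
  | .cmp _ _ _ => []
  | .neg G => G.assumed
  | .imp Rs G => Rs ++ G.assumed

/-- `Occurs P R`: the rule `R` is a rule of `P`, or it stands (at any depth) in the antecedent of
an embedded implication of `P`. -/
inductive Occurs (P : Program Name Val) : Rule Name Val → Prop
  | base {R : Rule Name Val} (h : R ∈ P) : Occurs P R
  | nested {R R' : Rule Name Val} {G : Goal Name Val} (h : Occurs P R) (hG : G ∈ R.body)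
      (hR' : R' ∈ G.assumed) : Occurs P R'

/-! ## Stratification and the unified stratified semantics -/

/-- The stratum of a goal, for an assignment `σ` of strata to predicates. -/
def Goal.level (σ : Name → ℕ) : Goal Name Val → ℕ
  | .atom A => σ A.pred
  | .cmp _ _ _ => 0
  | .neg G => G.level σ + 1
  | .imp _ G => G.level σ

/-- `σ` stratifies `P`: in each rule of `P`, assumed rules included, the head lies in a stratum at
least as high as that of each goal of the body, and strictly above that of each negated goal. -/
def IsStratification (σ : Name → ℕ) (P : Program Name Val) : Prop :=
  ∀ R, Occurs P R → ∀ G ∈ R.body, G.level σ ≤ σ R.head.pred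

/-- Identifiers of data sources: the source of an inferred fact is an occurrence of a rule (the
`k`-th copy of the rule `R`) together with the labelled goals to which the rule was applied.
A built-in comparison and a negation have just one source each. -/
inductive Source (Name : Type u) (Val : Type v) where
  | builtin
  | negation
  | rule (R : Rule Name Val) (k : ℕ) (premises : List (Source Name Val × Goal Name Val))

/-- A labelled sequent `P ⊢ id : ψ`. -/
structure Sequent (Name : Type u) (Val : Type v) where
  db : Program Name Val
  id : Source Name Val
  goal : Goal Name Val

open Classical in
/-- Closure of a set `E` of axioms (that of the lower strata) under the inference rules of the
stratum `s`. -/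
inductive Inferred [LinearOrder Val] (σ : Name → ℕ) (s : ℕ) (E : Set (Sequent Name Val)) :
    Sequent Name Val → Prop
  /-- What is known from lower strata. -/
  | lower {a : Sequent Name Val} (h : a ∈ E) : Inferred σ s E a
  /-- Built-in comparisons. -/
  | cmp {P : Program Name Val} {op : CmpOp} {a b : Val} (h : op.Holds a b) :
      Inferred σ s E ⟨P, .builtin, .cmp op (.const a) (.const b)⟩
  /-- Application of (the `k`-th copy of) a rule of the database under a substitution `θ`. -/
  | rule {P : Program Name Val} {R : Rule Name Val} {k : ℕ} (θ : ℕ → Val)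
      {premises : List (Source Name Val × Goal Name Val)}
      (hk : k < P.count R) (hs : σ R.head.pred ≤ s)
      (hbody : premises.map Prod.snd = R.body.map (Goal.subst θ))
      (h : ∀ q ∈ premises, Inferred σ s E ⟨P, q.1, q.2⟩) :
      Inferred σ s E ⟨P, .rule R k premises, .atom (R.head.subst θ)⟩
  /-- Negation as failure, for a goal whose stratum is already complete. -/
  | neg {P : Program Name Val} {G : Goal Name Val} (hs : G.level σ < s)
      (h : ∀ i, (⟨P, i, G⟩ : Sequent Name Val) ∉ E) :
      Inferred σ s E ⟨P, .negation, .neg G⟩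
  /-- Embedded implication: the assumed rules are added to the database. -/
  | imp {P : Program Name Val} {Rs : List (Rule Name Val)} {G : Goal Name Val}
      {i : Source Name Val} (h : Inferred σ s E ⟨P + (Rs : Multiset (Rule Name Val)), i, G⟩) :
      Inferred σ s E ⟨P, i, .imp Rs G⟩

/-- The axioms obtained up to the stratum `s`. -/
def stage [LinearOrder Val] (σ : Name → ℕ) : ℕ → Set (Sequent Name Val)
  | 0 => {a | Inferred σ 0 ∅ a}
  | s + 1 => {a | Inferred σ (s + 1) (stage σ s) a}

/-- The unified stratified semantics for `P`, along a stratification `σ` of `P`: all the axioms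
`P' ⊢ id : ψ` of all strata, for the databases `P'` that result from `P` by adding assumed rules
of `P`. -/
def unifiedSemantics [LinearOrder Val] (P : Program Name Val) (σ : Name → ℕ) :
    Set (Sequent Name Val) :=
  {a | P ≤ a.db ∧ (∀ R ∈ a.db, Occurs P R) ∧ ∃ s, a ∈ stage σ s}

/-- `solve(φ, E)`: the axioms of `E` whose goal is an instance of `φ`. -/
def solve (φ : Goal Name Val) (E : Set (Sequent Name Val)) : Set (Sequent Name Val) :=
  {a ∈ E | ∃ θ : ℕ → Val, φ.subst θ = a.goal}

/-- `P(E)`: the multiset of the `ψ` with `P ⊢ id : ψ ∈ E` for some `id`, one occurrence for each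
such `id`, given by its multiplicity function (which may a priori take the value `∞`). -/
noncomputable def meaningIn (P : Program Name Val) (E : Set (Sequent Name Val)) :
    Goal Name Val → ℕ∞ :=
  fun ψ => {i : Source Name Val | (⟨P, i, ψ⟩ : Sequent Name Val) ∈ E}.encard

open Classical in
/-- The multiplicity function of a finite multiset of goals. -/
noncomputable def countFun (m : Multiset (Goal Name Val)) : Goal Name Val → ℕ∞ :=
  fun ψ => (m.count ψ : ℕ∞)

/-! ## SQL: syntax

Attribute references are resolved to positions: `col i` is the `i`-th attribute (from 0) of the
relation to which a `SELECT` list or a condition refers. -/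

/-- Attribute references and literals. -/
inductive Expr (Val : Type v) where
  | col (i : ℕ)
  | lit (c : Val)

mutual

/-- SQL statements. -/
inductive Query (Name : Type u) (Val : Type v) where
  /-- `SELECT c₁, …, cₙ` without `FROM`. -/
  | values (cs : List Val)
  /-- `SELECT e₁, …, eₙ FROM R WHERE c`. -/
  | select (es : List (Expr Val)) (R : SqlRel Name Val) (c : Cond Name Val)
  /-- `Q₁ UNION ALL Q₂`. -/
  | unionAll (Q₁ Q₂ : Query Name Val)
  /-- `WITH r₁ AS Q₁, …, rₙ AS Qₙ Q`. -/
  | withViews (vs : Views Name Val) (Q : Query Name Val)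

/-- Relations of a `FROM` clause, or to the right of `[NOT] IN` and `EXISTS`. -/
inductive SqlRel (Name : Type u) (Val : Type v) where
  /-- A table or a view. -/
  | name (R : Name)
  /-- An SQL statement. -/
  | stmt (Q : Query Name Val)
  /-- `R₁ JOIN R₂ ON c`; with the true condition this is the product `R₁, R₂`. -/
  | join (R₁ R₂ : SqlRel Name Val) (c : Cond Name Val)

/-- Conditions. -/
inductive Cond (Name : Type u) (Val : Type v) where
  | tt
  | cmp (op : CmpOp) (e₁ e₂ : Expr Val)
  | isIn (es : List (Expr Val)) (R : SqlRel Name Val)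
  | notIn (es : List (Expr Val)) (R : SqlRel Name Val)
  | exist (R : SqlRel Name Val)
  | and (c₁ c₂ : Cond Name Val)
  | or (c₁ c₂ : Cond Name Val)
  | not (c : Cond Name Val)

/-- The list `r₁ AS Q₁, …, rₙ AS Qₙ` of temporary views of a `WITH` clause. -/
inductive Views (Name : Type u) (Val : Type v) where
  | nil
  | cons (r : Name) (Q : Query Name Val) (vs : Views Name Val)

end

/-- The number of attributes of the answer of a statement. -/
def Query.degree : Query Name Val → ℕ
  | .values cs => cs.length
  | .select es _ _ => es.length
  | .unionAll Q₁ _ => Q₁.degree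
  | .withViews _ Q => Q.degree

/-- A scope assigns to each visible relation name its degree. -/
abbrev Scope (Name : Type u) := Name → Option ℕ

/-- The number of attributes of a relation. -/
def SqlRel.degree (Γ : Scope Name) : SqlRel Name Val → ℕ
  | .name R => (Γ R).getD 0
  | .stmt Q => Q.degree
  | .join R₁ R₂ _ => R₁.degree Γ + R₂.degree Γ

/-- The names `r₁, …, rₙ` that a `WITH` clause declares. -/
def Views.names : Views Name Val → List Name
  | .nil => []
  | .cons r _ vs => r :: vs.names

/-- The scope of the main statement of a `WITH` clause. -/
def Views.scope [DecidableEq Name] (Γ : Scope Name) : Views Name Val → Scope Name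
  | .nil => Γ
  | .cons r Q vs => Function.update (vs.scope Γ) r (some Q.degree)

mutual

/-- All the view names that the `WITH` clauses in a statement declare, once for each
declaration. -/
def Query.declared : Query Name Val → List Name
  | .values _ => []
  | .select _ R c => R.declared ++ c.declared
  | .unionAll Q₁ Q₂ => Q₁.declared ++ Q₂.declared
  | .withViews vs Q => vs.names ++ vs.declared ++ Q.declared

def SqlRel.declared : SqlRel Name Val → List Name
  | .name _ => []
  | .stmt Q => Q.declared
  | .join R₁ R₂ c => R₁.declared ++ R₂.declared ++ c.declared

def Cond.declared : Cond Name Val → List Name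
  | .tt => []
  | .cmp _ _ _ => []
  | .isIn _ R => R.declared
  | .notIn _ R => R.declared
  | .exist R => R.declared
  | .and c₁ c₂ => c₁.declared ++ c₂.declared
  | .or c₁ c₂ => c₁.declared ++ c₂.declared
  | .not c => c.declared

/-- The names declared inside the definitions of the views (not the `rᵢ` themselves). -/
def Views.declared : Views Name Val → List Name
  | .nil => []
  | .cons _ Q vs => Q.declared ++ vs.declared

end

/-- An expression refers to attributes of a relation of degree `k` only. -/
def Expr.WF (k : ℕ) : Expr Val → Prop
  | .col i => i < k
  | .lit _ => True

mutual

/-- Well-formed statements in a scope: degrees fit, attributes exist, relation names are visible,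
and view names do not clash. The names that a `WITH` clause declares are visible only in its main
statement. -/
def Query.WF [DecidableEq Name] (Γ : Scope Name) : Query Name Val → Prop
  | .values _ => True
  | .select es R c =>
      R.WF Γ ∧ (∀ e ∈ es, e.WF (R.degree Γ)) ∧ c.WF Γ (R.degree Γ)
  | .unionAll Q₁ Q₂ => Q₁.WF Γ ∧ Q₂.WF Γ ∧ Q₁.degree = Q₂.degree
  | .withViews vs Q =>
      vs.names.Nodup ∧
      (∀ r ∈ vs.names, Γ r = none ∧ r ∉ vs.declared ∧ r ∉ Q.declared) ∧
      (∀ r ∈ vs.declared, r ∉ Q.declared) ∧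
      vs.WF Γ ∧ Q.WF (vs.scope Γ)

def SqlRel.WF [DecidableEq Name] (Γ : Scope Name) : SqlRel Name Val → Prop
  | .name R => (Γ R).isSome
  | .stmt Q => Q.WF Γ
  | .join R₁ R₂ c => R₁.WF Γ ∧ R₂.WF Γ ∧ c.WF Γ (R₁.degree Γ + R₂.degree Γ)

/-- Conditions on the tuples of a relation of degree `k`. -/
def Cond.WF [DecidableEq Name] (Γ : Scope Name) (k : ℕ) : Cond Name Val → Prop
  | .tt => True
  | .cmp _ e₁ e₂ => e₁.WF k ∧ e₂.WF k
  | .isIn es R => (∀ e ∈ es, e.WF k) ∧ R.WF Γ ∧ es.length = R.degree Γ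
  | .notIn es R => (∀ e ∈ es, e.WF k) ∧ R.WF Γ ∧ es.length = R.degree Γ
  | .exist R => R.WF Γ
  | .and c₁ c₂ => c₁.WF Γ k ∧ c₂.WF Γ k
  | .or c₁ c₂ => c₁.WF Γ k ∧ c₂.WF Γ k
  | .not c => c.WF Γ k

def Views.WF [DecidableEq Name] (Γ : Scope Name) : Views Name Val → Prop
  | .nil => True
  | .cons _ Q vs => Q.WF Γ ∧ vs.WF Γ

end

/-! ## SQL: semantics

Each statement denotes an expression of the extended relational algebra, built from the multiset
versions of projection, selection, product and union. -/

/-- A database instance: finitely many tables, each with a degree and a multiset of tuples. -/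
structure Database (Name : Type u) (Val : Type v) where
  tables : Finset Name
  degree : Name → ℕ
  inst : Name → Multiset (List Val)
  length_eq : ∀ T ∈ tables, ∀ t ∈ inst T, t.length = degree T

/-- The scope in which only the tables are visible. -/
def Database.scope [DecidableEq Name] (Δ : Database Name Val) : Scope Name :=
  fun T => if T ∈ Δ.tables then some (Δ.degree T) else none

/-- The value of an expression on a tuple. -/
def Expr.eval [Inhabited Val] (t : List Val) : Expr Val → Val
  | .col i => t.getD i default
  | .lit c => c

/-- Projection. -/
def project [Inhabited Val] (es : List (Expr Val)) (m : Multiset (List Val)) :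
    Multiset (List Val) :=
  m.map fun t => es.map (Expr.eval t)

open Classical in
/-- Selection. -/
noncomputable def selection (p : List Val → Prop) (m : Multiset (List Val)) :
    Multiset (List Val) :=
  m.filter p

/-- Product. -/
def product (m₁ m₂ : Multiset (List Val)) : Multiset (List Val) :=
  (m₁ ×ˢ m₂).map fun q => q.1 ++ q.2

section Semantics

variable [DecidableEq Name] [Inhabited Val] [LinearOrder Val]

mutual

/-- The answer of a statement, when the visible relations have the instances `ρ`. -/
noncomputable def Query.eval (ρ : Name → Multiset (List Val)) :
    Query Name Val → Multiset (List Val)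
  | .values cs => {cs}
  | .select es R c => project es (selection (fun t => t ∈ c.sat ρ) (R.eval ρ))
  | .unionAll Q₁ Q₂ => Q₁.eval ρ + Q₂.eval ρ
  | .withViews vs Q => Q.eval fun x => vs.eval ρ x

noncomputable def SqlRel.eval (ρ : Name → Multiset (List Val)) :
    SqlRel Name Val → Multiset (List Val)
  | .name R => ρ R
  | .stmt Q => Q.eval ρ
  | .join R₁ R₂ c => selection (fun t => t ∈ c.sat ρ) (product (R₁.eval ρ) (R₂.eval ρ))

/-- The set of the tuples for which the condition holds. -/
noncomputable def Cond.sat (ρ : Name → Multiset (List Val)) : Cond Name Val → Set (List Val)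
  | .tt => Set.univ
  | .cmp op e₁ e₂ => {t | op.Holds (e₁.eval t) (e₂.eval t)}
  | .isIn es R => {t | es.map (Expr.eval t) ∈ R.eval ρ}
  | .notIn es R => {t | es.map (Expr.eval t) ∉ R.eval ρ}
  | .exist R => {_t | R.eval ρ ≠ 0}
  | .and c₁ c₂ => c₁.sat ρ ∩ c₂.sat ρ
  | .or c₁ c₂ => c₁.sat ρ ∪ c₂.sat ρ
  | .not c => (c.sat ρ)ᶜ

/-- The instance of the relation `x`, when the instances `ρ` are extended by the temporary
views. -/
noncomputable def Views.eval (ρ : Name → Multiset (List Val)) (x : Name) :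
    Views Name Val → Multiset (List Val)
  | .nil => ρ x
  | .cons r Q vs => if x = r then Q.eval ρ else vs.eval ρ x

end

/-- The computed answer of a statement with respect to a database instance. -/
noncomputable def computedAnswer (Δ : Database Name Val) (Q : Query Name Val) :
    Multiset (List Val) :=
  Q.eval fun T => if T ∈ Δ.tables then Δ.inst T else 0

/-- A correct SQL implementation returns the computed answer of every (well-formed) query. -/
def IsCorrectImplementation (ans : Database Name Val → Query Name Val → Multiset (List Val)) :
    Prop :=
  ∀ (Δ : Database Name Val) (Q : Query Name Val), Q.WF Δ.scope → ans Δ Q = computedAnswer Δ Q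

end Semantics

/-! ## Translation of SQL into Hypothetical Datalog

Fresh goal names are supplied by a map `g` from the positions in the syntax tree (lists of
numbers). Multisets of rules are enumerated by lists. -/

/-- The list of variables `X_m, …, X_{m+n-1}`. -/
def varsFrom (m n : ℕ) : List (Term Val) :=
  (List.range' m n).map .var

/-- The goal `p(X_m, …, X_{m+n-1})`. -/
def varGoal (p : Name) (m n : ℕ) : Goal Name Val :=
  .atom ⟨p, varsFrom m n⟩

def Expr.toTerm : Expr Val → Term Val
  | .col i => .var i
  | .lit c => .const c

section Translation

variable [DecidableEq Name]

mutual

/-- `SQL_to_DL(r, Q)`, for the statement `Q` at position `p` in the scope `Γ`. -/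
def Query.toDL (g : List ℕ → Name) (Γ : Scope Name) (p : List ℕ) (r : Name) :
    Query Name Val → List (Rule Name Val)
  | .values cs => [.mk ⟨r, cs.map .const⟩ []]
  | .select es R c =>
      let relDL := R.toDL g Γ (p ++ [0])
      let relGoal := varGoal relDL.1 0 (R.degree Γ)
      let condDL := c.toDL g Γ (p ++ [1]) [relGoal] (R.degree Γ)
      .mk ⟨r, es.map Expr.toTerm⟩ (relGoal :: condDL.1) :: (relDL.2 ++ condDL.2)
  | .unionAll Q₁ Q₂ => Q₁.toDL g Γ (p ++ [0]) r ++ Q₂.toDL g Γ (p ++ [1]) r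
  | .withViews vs Q =>
      let s := g p
      .mk ⟨r, varsFrom 0 Q.degree⟩
          [.imp (vs.toDL g Γ (p ++ [0])) (varGoal s 0 Q.degree)] ::
        Q.toDL g (vs.scope Γ) (p ++ [1]) s

/-- `SQLREL_to_DL(R)`: a predicate whose goal `DLRel(X̄)` stands for the relation, and additional
rules. -/
def SqlRel.toDL (g : List ℕ → Name) (Γ : Scope Name) (p : List ℕ) :
    SqlRel Name Val → Name × List (Rule Name Val)
  | .name R => (R, [])
  | .stmt Q => (g p, Q.toDL g Γ (p ++ [0]) (g p))
  | .join R₁ R₂ c =>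
      let relDL₁ := R₁.toDL g Γ (p ++ [0])
      let relDL₂ := R₂.toDL g Γ (p ++ [1])
      let n₁ := R₁.degree Γ
      let n₂ := R₂.degree Γ
      let goals := [varGoal relDL₁.1 0 n₁, varGoal relDL₂.1 n₁ n₂]
      let condDL := c.toDL g Γ (p ++ [2]) goals (n₁ + n₂)
      (g p, .mk ⟨g p, varsFrom 0 (n₁ + n₂)⟩ (goals ++ condDL.1) ::
        (relDL₁.2 ++ relDL₂.2 ++ condDL.2))

/-- `SQLCOND_to_DL(c)`: a conjunction of goals, and additional rules. The condition is about the
tuples `(X_0, …, X_{k-1})` described by the goals `guard`; the rules for `OR` and `NOT` repeat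
them, so that each variable of such a rule occurs in a positive goal. Conditions are translated
into goals that have at most one data source, so that they do not change multiplicities. -/
def Cond.toDL (g : List ℕ → Name) (Γ : Scope Name) (p : List ℕ) (guard : List (Goal Name Val))
    (k : ℕ) : Cond Name Val → List (Goal Name Val) × List (Rule Name Val)
  | .tt => ([], [])
  | .cmp op e₁ e₂ => ([.cmp op e₁.toTerm e₂.toTerm], [])
  | .isIn es R =>
      let relDL := R.toDL g Γ (p ++ [0])
      ([.neg (.neg (.atom ⟨relDL.1, es.map Expr.toTerm⟩))], relDL.2)
  | .notIn es R =>
      let relDL := R.toDL g Γ (p ++ [0])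
      ([.neg (.atom ⟨relDL.1, es.map Expr.toTerm⟩)], relDL.2)
  | .exist R =>
      let relDL := R.toDL g Γ (p ++ [0])
      ([.neg (.neg (varGoal (g p) 0 0))],
        .mk ⟨g p, []⟩ [varGoal relDL.1 0 (R.degree Γ)] :: relDL.2)
  | .and c₁ c₂ =>
      let condDL₁ := c₁.toDL g Γ (p ++ [0]) guard k
      let condDL₂ := c₂.toDL g Γ (p ++ [1]) guard k
      (condDL₁.1 ++ condDL₂.1, condDL₁.2 ++ condDL₂.2)
  | .or c₁ c₂ =>
      let condDL₁ := c₁.toDL g Γ (p ++ [0]) guard k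
      let condDL₂ := c₂.toDL g Γ (p ++ [1]) guard k
      ([.neg (.neg (varGoal (g p) 0 k))],
        .mk ⟨g p, varsFrom 0 k⟩ (guard ++ condDL₁.1) ::
        .mk ⟨g p, varsFrom 0 k⟩ (guard ++ condDL₂.1) :: (condDL₁.2 ++ condDL₂.2))
  | .not c =>
      let condDL := c.toDL g Γ (p ++ [0]) guard k
      ([.neg (varGoal (g p) 0 k)],
        .mk ⟨g p, varsFrom 0 k⟩ (guard ++ condDL.1) :: condDL.2)

/-- The union of the `SQL_to_DL(rᵢ, Qᵢ)`. -/
def Views.toDL (g : List ℕ → Name) (Γ : Scope Name) (p : List ℕ) :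
    Views Name Val → List (Rule Name Val)
  | .nil => []
  | .cons r Q vs => Q.toDL g Γ (p ++ [0]) r ++ vs.toDL g Γ (p ++ [1])

end

/-- The fact `r(t)`. -/
def factAtom (r : Name) (t : List Val) : Atom Name Val :=
  ⟨r, t.map .const⟩

/-- A database instance as a multiset of facts. -/
def Database.facts (Δ : Database Name Val) : Program Name Val :=
  ∑ T ∈ Δ.tables, (Δ.inst T).map fun t => .mk (factAtom T t) []

/-- `SQL_to_DL(r, Q)` for a statement over the tables of `Δ`. -/
def sqlToDL (g : List ℕ → Name) (Δ : Database Name Val) (r : Name) (Q : Query Name Val) :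
    Program Name Val :=
  (Q.toDL g Δ.scope [] r : Multiset (Rule Name Val))

/-- `g` supplies pairwise distinct new names: they differ from the tables, from `r` and from the
view names of `Q`. -/
def IsFreshSupply (g : List ℕ → Name) (Δ : Database Name Val) (r : Name) (Q : Query Name Val) :
    Prop :=
  Function.Injective g ∧ ∀ p, g p ∉ Δ.tables ∧ g p ≠ r ∧ g p ∉ Q.declared

end Translation

end HypSQL

open HypSQL

namespace HypSQL

universe u v

variable {Name : Type u} {Val : Type v}

/-! ## Derivability in the stratified semantics -/

/-- `P ⊢ i : G` belongs to some stage of the stratified semantics. -/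
def Der [LinearOrder Val] (σ : Name → ℕ) (P : Program Name Val) (i : Source Name Val)
    (G : Goal Name Val) : Prop :=
  ∃ s, (⟨P, i, G⟩ : Sequent Name Val) ∈ stage σ s

/-- The number of sources from which `G` is derivable. -/
noncomputable def mult [LinearOrder Val] (σ : Name → ℕ) (P : Program Name Val)
    (G : Goal Name Val) : ℕ∞ :=
  {i | Der σ P i G}.encard

/-- The lists of labelled goals that justify the ground goals `Gs`. -/
def wit [LinearOrder Val] (σ : Name → ℕ) (P : Program Name Val) (Gs : List (Goal Name Val)) :
    Set (List (Source Name Val × Goal Name Val)) :=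
  {l | l.map Prod.snd = Gs ∧ ∀ q ∈ l, Der σ P q.1 q.2}

/-- The lists of premises from which an application of the rule `R` yields the atom `A`. -/
def applications [LinearOrder Val] (σ : Name → ℕ) (P : Program Name Val) (R : Rule Name Val)
    (A : Atom Name Val) : Set (List (Source Name Val × Goal Name Val)) :=
  {l | ∃ θ : ℕ → Val, R.head.subst θ = A ∧ l ∈ wit σ P (R.body.map (Goal.subst θ))}

/-- The number of ways to derive the atom `A` with (one copy of) the rule `R`. -/
noncomputable def ways [LinearOrder Val] (σ : Name → ℕ) (P : Program Name Val)
    (A : Atom Name Val) (R : Rule Name Val) : ℕ∞ :=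
  (applications σ P R A).encard

@[simp] theorem Goal.level_subst {σ : Name → ℕ} (θ : ℕ → Val) :
    ∀ G : Goal Name Val, (G.subst θ).level σ = G.level σ
  | .atom A => by simp [Goal.subst, Goal.level, Atom.subst]
  | .cmp _ _ _ => by simp [Goal.subst, Goal.level]
  | .neg G => by simp [Goal.subst, Goal.level, Goal.level_subst θ G]
  | .imp _ G => by simp [Goal.subst, Goal.level, Goal.level_subst θ G]

@[simp] theorem Goal.assumed_subst (θ : ℕ → Val) :
    ∀ G : Goal Name Val, (G.subst θ).assumed = G.assumed
  | .atom A => by simp [Goal.subst, Goal.assumed]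
  | .cmp _ _ _ => by simp [Goal.subst, Goal.assumed]
  | .neg G => by simp [Goal.subst, Goal.assumed, Goal.assumed_subst θ G]
  | .imp _ G => by simp [Goal.subst, Goal.assumed, Goal.assumed_subst θ G]

section Derivability

variable [LinearOrder Val] {σ : Name → ℕ}

theorem stage_mono {s s' : ℕ} (h : s ≤ s') :
    (stage σ s : Set (Sequent Name Val)) ⊆ stage σ s' := by
  induction h with
  | refl => exact subset_rfl
  | step _ ih => exact fun a ha => Inferred.lower (ih ha)

/-- The axioms of the strata below `s`. -/
def stageBelow (σ : Name → ℕ) : ℕ → Set (Sequent Name Val)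
  | 0 => ∅
  | s + 1 => stage σ s

theorem mem_stage_iff {s : ℕ} {a : Sequent Name Val} :
    a ∈ stage σ s ↔ Inferred σ s (stageBelow σ s) a := by
  cases s <;> rfl

open Classical in
/-- In the databases that arise from a stratified one, later strata do not add axioms for the
goals of a completed stratum. -/
theorem mem_stage_of_level_le {P₀ : Program Name Val} (hσ : IsStratification σ P₀) {s s' : ℕ}
    (hs : s ≤ s') {a : Sequent Name Val} (ha : a ∈ stage σ s')
    (hdb : ∀ R ∈ a.db, Occurs P₀ R) (hG : ∀ R ∈ a.goal.assumed, Occurs P₀ R)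
    (hl : a.goal.level σ ≤ s) : a ∈ stage σ s := by
  induction hs generalizing a with
  | refl => exact ha
  | @step m hm ih =>
    change Inferred σ (m + 1) (stage σ m) a at ha
    induction ha with
    | lower h => exact ih h hdb hG hl
    | cmp h => exact mem_stage_iff.2 (.cmp h)
    | @rule P R k θ premises hk _ hbody _ ihp =>
      refine mem_stage_iff.2 (.rule θ hk hl hbody fun q hq => mem_stage_iff.1 ?_)
      have hmem : q.2 ∈ R.body.map (Goal.subst θ) := hbody ▸ List.mem_map_of_mem hq
      obtain ⟨G, hGb, hGq⟩ := List.mem_map.1 hmem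
      have hR : Occurs P₀ R := hdb R (Multiset.count_pos.1 (Nat.zero_lt_of_lt hk))
      refine ihp q hq hdb ?_ ?_
      · intro R' hR'
        refine .nested hR hGb ?_
        simpa [← hGq] using hR'
      · have := hσ R hR G hGb
        have h2 : σ R.head.pred ≤ s := hl
        simp only [← hGq, Goal.level_subst]
        omega
    | @neg P G h1 h2 =>
      have hl' : G.level σ + 1 ≤ s := hl
      obtain ⟨t, rfl⟩ : ∃ t, s = t + 1 := ⟨s - 1, by omega⟩
      have htm : t ≤ m := by have : t + 1 ≤ m := hm; omega
      exact Inferred.neg (by omega) fun i hi => h2 i (stage_mono htm hi)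
    | @imp P Rs G i _ ihp =>
      refine mem_stage_iff.2 (.imp (mem_stage_iff.1 (ihp ?_ ?_ hl)))
      · intro R hR
        rcases Multiset.mem_add.1 hR with h | h
        · exact hdb R h
        · exact hG R (List.mem_append_left _ (Multiset.mem_coe.1 h))
      · exact fun R hR => hG R (List.mem_append_right _ hR)

theorem der_cmp_iff {P : Program Name Val} {i : Source Name Val} {op : CmpOp} {a b : Val} :
    Der σ P i (.cmp op (.const a) (.const b)) ↔ i = .builtin ∧ op.Holds a b := by
  constructor
  · rintro ⟨s, hs⟩
    induction s with
    | zero =>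
      cases hs with
      | lower h => exact h.elim
      | cmp h => exact ⟨rfl, h⟩
    | succ s ih =>
      cases hs with
      | lower h => exact ih h
      | cmp h => exact ⟨rfl, h⟩
  · rintro ⟨rfl, h⟩
    exact ⟨0, .cmp h⟩

theorem der_imp_iff {P : Program Name Val} {i : Source Name Val} {Rs : List (Rule Name Val)}
    {G : Goal Name Val} :
    Der σ P i (.imp Rs G) ↔ Der σ (P + (Rs : Multiset (Rule Name Val))) i G := by
  constructor
  · rintro ⟨s, hs⟩
    induction s with
    | zero =>
      cases hs with
      | lower h => exact h.elim
      | imp h => exact ⟨0, h⟩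
    | succ s ih =>
      cases hs with
      | lower h => exact ih h
      | imp h => exact ⟨s + 1, h⟩
  · rintro ⟨s, hs⟩
    exact ⟨s, mem_stage_iff.2 (.imp (mem_stage_iff.1 hs))⟩

theorem der_neg_iff {P₀ : Program Name Val} (hσ : IsStratification σ P₀) {P : Program Name Val}
    (hP : ∀ R ∈ P, Occurs P₀ R) {i : Source Name Val} {G : Goal Name Val}
    (hG : ∀ R ∈ G.assumed, Occurs P₀ R) :
    Der σ P i (.neg G) ↔ i = .negation ∧ ¬ ∃ j, Der σ P j G := by
  constructor
  · rintro ⟨s, hs⟩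
    induction s with
    | zero =>
      cases hs with
      | lower h => exact h.elim
      | neg h => omega
    | succ s ih =>
      cases hs with
      | lower h => exact ih h
      | neg h1 h2 =>
        refine ⟨rfl, ?_⟩
        rintro ⟨j, t, hj⟩
        rcases le_total s t with h | h
        · exact h2 j (mem_stage_of_level_le hσ h hj hP hG (by simpa using Nat.lt_succ_iff.1 h1))
        · exact h2 j (stage_mono h hj)
  · rintro ⟨rfl, h⟩
    refine ⟨G.level σ + 1, Inferred.neg (by omega) fun j hj => h ⟨j, _, hj⟩⟩

open Classical in
theorem der_atom_iff {P : Program Name Val} {i : Source Name Val} {A : Atom Name Val} :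
    Der σ P i (.atom A) ↔ ∃ R k l, i = .rule R k l ∧ k < P.count R ∧ l ∈ applications σ P R A := by
  constructor
  · rintro ⟨s, hs⟩
    have key : ∀ s, ∀ a ∈ (stageBelow σ s : Set (Sequent Name Val)), ∃ t < s, a ∈ stage σ t := by
      intro s a ha
      cases s with
      | zero => exact ha.elim
      | succ s => exact ⟨s, s.lt_succ_self, ha⟩
    induction s using Nat.strong_induction_on with
    | _ s ih =>
      cases mem_stage_iff.1 hs with
      | lower h =>
        obtain ⟨t, ht, hat⟩ := key _ _ h
        exact ih t ht hat
      | @rule _ R k θ l hk hs hbody h =>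
        exact ⟨R, k, l, rfl, hk, θ, rfl, hbody, fun q hq => ⟨s, mem_stage_iff.2 (h q hq)⟩⟩
  · rintro ⟨R, k, l, rfl, hk, θ, rfl, hbody, h⟩
    have : ∃ s, ∀ q ∈ l, (⟨P, q.1, q.2⟩ : Sequent Name Val) ∈ stage σ s := by
      clear hbody
      induction l with
      | nil => exact ⟨0, by simp⟩
      | cons a l ih =>
        obtain ⟨s, hs⟩ := ih fun q hq => h q (List.mem_cons_of_mem _ hq)
        obtain ⟨t, ht⟩ := h a List.mem_cons_self
        refine ⟨max s t, fun q hq => ?_⟩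
        rcases List.mem_cons.1 hq with rfl | hq
        · exact stage_mono (le_max_right _ _) ht
        · exact stage_mono (le_max_left _ _) (hs q hq)
    obtain ⟨s, hs⟩ := this
    refine ⟨max s (σ R.head.pred), mem_stage_iff.2 (.rule θ hk (le_max_right _ _) hbody
      fun q hq => mem_stage_iff.1 (stage_mono (le_max_left _ _) (hs q hq)))⟩

theorem wit_nonempty_iff {P : Program Name Val} {Gs : List (Goal Name Val)} :
    (wit σ P Gs).Nonempty ↔ ∀ G ∈ Gs, ∃ i, Der σ P i G := by
  constructor
  · rintro ⟨l, rfl, hl⟩ G hG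
    obtain ⟨q, hq, rfl⟩ := List.mem_map.1 hG
    exact ⟨q.1, hl q hq⟩
  · intro h
    choose f hf using h
    refine ⟨Gs.attach.map fun G => (f G.1 G.2, G.1), by simp, ?_⟩
    intro q hq
    obtain ⟨G, -, rfl⟩ := List.mem_map.1 hq
    exact hf _ _

theorem exists_der_atom_iff {P : Program Name Val} {A : Atom Name Val} :
    (∃ i, Der σ P i (.atom A)) ↔ ∃ R ∈ P, ∃ θ : ℕ → Val, R.head.subst θ = A ∧
      ∀ G ∈ R.body, ∃ i, Der σ P i (G.subst θ) := by
  classical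
  constructor
  · rintro ⟨i, hi⟩
    obtain ⟨R, k, l, -, hk, θ, hA, hl⟩ := der_atom_iff.1 hi
    refine ⟨R, Multiset.count_pos.1 (by omega), θ, hA, fun G hG => ?_⟩
    exact wit_nonempty_iff.1 ⟨l, hl⟩ _ (List.mem_map_of_mem hG)
  · rintro ⟨R, hR, θ, hA, h⟩
    obtain ⟨l, hl⟩ : (wit σ P (R.body.map (Goal.subst θ))).Nonempty :=
      wit_nonempty_iff.2 (by simpa using h)
    exact ⟨_, der_atom_iff.2 ⟨R, 0, l, rfl, Multiset.count_pos.2 hR, θ, hA, hl⟩⟩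

/-! ## Counting sources -/

theorem encard_biUnion_finset {α β : Type*} (s : Finset α) (f : α → Set β)
    (h : ∀ a ∈ s, ∀ b ∈ s, a ≠ b → Disjoint (f a) (f b)) :
    (⋃ a ∈ s, f a).encard = ∑ a ∈ s, (f a).encard := by
  classical
  induction s using Finset.induction_on with
  | empty => simp
  | insert a s ha ih =>
    rw [Finset.set_biUnion_insert, Set.encard_union_eq, Finset.sum_insert ha, ih]
    · exact fun b hb c hc => h b (Finset.mem_insert_of_mem hb) c (Finset.mem_insert_of_mem hc)
    · rw [Set.disjoint_iUnion₂_right]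
      exact fun b hb => h a (Finset.mem_insert_self _ _) b (Finset.mem_insert_of_mem hb)
        (by rintro rfl; exact ha hb)

theorem mult_atom (P : Program Name Val) (A : Atom Name Val) :
    mult σ P (.atom A) = (P.map (ways σ P A)).sum := by
  classical
  have hset : {i | Der σ P i (.atom A)} = ⋃ R ∈ P.toFinset,
      (fun q : ℕ × List (Source Name Val × Goal Name Val) => Source.rule R q.1 q.2) ''
        (Set.Iio (P.count R) ×ˢ applications σ P R A) := by
    ext i
    simp only [Set.mem_ofPred_eq, der_atom_iff, Set.mem_iUnion, Set.mem_image, Set.mem_prod,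
      Set.mem_Iio, Prod.exists, Multiset.mem_toFinset]
    constructor
    · rintro ⟨R, k, l, rfl, hk, hl⟩
      exact ⟨R, Multiset.count_pos.1 (by omega), k, l, ⟨hk, hl⟩, rfl⟩
    · rintro ⟨R, -, k, l, ⟨hk, hl⟩, rfl⟩
      exact ⟨R, k, l, rfl, hk, hl⟩
  rw [mult, hset, encard_biUnion_finset, Finset.sum_multiset_map_count]
  · refine Finset.sum_congr rfl fun R _ => ?_
    rw [Function.Injective.encard_image, Set.encard_prod, nsmul_eq_mul, ways]
    · congr 1
      simp [← Finset.coe_Iio, Set.encard_coe_eq_coe_finsetCard]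
    · rintro ⟨a, b⟩ ⟨c, d⟩ h
      simpa using h
  · intro R _ R' _ hne
    rw [Set.disjoint_left]
    rintro _ ⟨q, -, rfl⟩ ⟨q', -, h⟩
    simp only [Source.rule.injEq] at h
    exact hne h.1.symm

theorem ways_eq_zero {P : Program Name Val} {A : Atom Name Val} {R : Rule Name Val}
    (h : R.head.pred ≠ A.pred) : ways σ P A R = 0 := by
  rw [ways, Set.encard_eq_zero, Set.eq_empty_iff_forall_notMem]
  rintro l ⟨θ, rfl, -⟩
  exact h rfl

theorem sum_ways_eq_zero {P : Program Name Val} {A : Atom Name Val} {L : Program Name Val}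
    (h : ∀ R ∈ L, R.head.pred ≠ A.pred) : (L.map (ways σ P A)).sum = 0 := by
  refine Multiset.sum_eq_zero fun x hx => ?_
  obtain ⟨R, hR, rfl⟩ := Multiset.mem_map.1 hx
  exact ways_eq_zero (h R hR)

theorem wit_nil (P : Program Name Val) : wit σ P [] = {[]} := by
  ext l
  simp only [wit, List.map_eq_nil_iff, Set.mem_ofPred_eq, Set.mem_singleton_iff]
  constructor
  · exact fun h => h.1
  · rintro rfl; simp

theorem encard_wit_cons (P : Program Name Val) (G : Goal Name Val) (Gs : List (Goal Name Val)) :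
    (wit σ P (G :: Gs)).encard = mult σ P G * (wit σ P Gs).encard := by
  have : wit σ P (G :: Gs) =
      (fun q : Source Name Val × List (Source Name Val × Goal Name Val) => (q.1, G) :: q.2) ''
        ({i | Der σ P i G} ×ˢ wit σ P Gs) := by
    ext l
    simp only [wit, Set.mem_ofPred_eq, Set.mem_image, Set.mem_prod, Prod.exists]
    constructor
    · rintro ⟨h1, h2⟩
      obtain ⟨a, l, rfl, rfl, rfl⟩ := List.map_eq_cons_iff.1 h1
      simp only [List.mem_cons, forall_eq_or_imp] at h2
      exact ⟨a.1, l, ⟨h2.1, rfl, h2.2⟩, rfl⟩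
    · rintro ⟨i, l, ⟨h1, rfl, h2⟩, rfl⟩
      simp only [List.map_cons, List.mem_cons, forall_eq_or_imp, true_and]
      exact ⟨h1, h2⟩
  rw [this, Function.Injective.encard_image, Set.encard_prod, mult]
  rintro ⟨a, b⟩ ⟨c, d⟩ h
  simpa using h

theorem encard_wit_append (P : Program Name Val) (Gs Gs' : List (Goal Name Val)) :
    (wit σ P (Gs ++ Gs')).encard = (wit σ P Gs).encard * (wit σ P Gs').encard := by
  induction Gs with
  | nil => simp [wit_nil]
  | cons G Gs ih => simp [encard_wit_cons, ih, mul_assoc]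

open Classical in
/-- Goals with at most one source do not change multiplicities. -/
theorem encard_wit_of_mult_le_one {P : Program Name Val} {Gs : List (Goal Name Val)}
    (h : ∀ G ∈ Gs, mult σ P G ≤ 1) :
    (wit σ P Gs).encard = if ∀ G ∈ Gs, ∃ i, Der σ P i G then 1 else 0 := by
  have hle : (wit σ P Gs).encard ≤ 1 := by
    induction Gs with
    | nil => simp [wit_nil]
    | cons G Gs ih =>
      rw [encard_wit_cons]
      exact mul_le_one' (h G List.mem_cons_self)
        (ih fun G' hG' => h G' (List.mem_cons_of_mem _ hG'))
  split_ifs with hd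
  · exact le_antisymm hle (Set.one_le_encard_iff_nonempty.2 (wit_nonempty_iff.2 hd))
  · rw [Set.encard_eq_zero, ← Set.not_nonempty_iff_eq_empty, wit_nonempty_iff]
    exact hd

end Derivability

/-! ## Rules that range over the tuples of a multiset -/

/-- The values of the first `k` variables. -/
def tuple (θ : ℕ → Val) (k : ℕ) : List Val :=
  (List.range k).map θ

@[simp] theorem length_tuple (θ : ℕ → Val) (k : ℕ) : (tuple θ k).length = k := by
  simp [tuple]

theorem tuple_getD [Inhabited Val] {x : List Val} {k : ℕ} (h : x.length = k) :
    tuple (fun i => x.getD i default) k = x := by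
  subst h
  apply List.ext_getElem
  · simp
  · intro i h1 h2
    simp [tuple, h2]

theorem map_const_injective : Function.Injective (List.map (Term.const : Val → Term Val)) :=
  List.map_injective_iff.2 fun _ _ h => by simpa using h

@[simp] theorem factAtom_inj {r r' : Name} {t t' : List Val} :
    factAtom r t = factAtom r' t' ↔ r = r' ∧ t = t' := by
  simp [factAtom, map_const_injective.eq_iff]

theorem map_subst_varsFrom (θ : ℕ → Val) (m n : ℕ) :
    (varsFrom m n).map (Term.subst θ) = ((List.range' m n).map θ).map .const := by
  simp [varsFrom, Term.subst]

theorem subst_varAtom (θ : ℕ → Val) (p : Name) (k : ℕ) :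
    (⟨p, varsFrom 0 k⟩ : Atom Name Val).subst θ = factAtom p (tuple θ k) := by
  simp [Atom.subst, factAtom, map_subst_varsFrom, tuple, List.range_eq_range']

theorem subst_varGoal (θ : ℕ → Val) (p : Name) (m n : ℕ) :
    (varGoal p m n : Goal Name Val).subst θ =
      .atom (factAtom p ((List.range' m n).map θ)) := by
  simp only [varGoal, Goal.subst, Atom.subst, factAtom, map_subst_varsFrom]

theorem subst_varGoal_zero (θ : ℕ → Val) (p : Name) (k : ℕ) :
    (varGoal p 0 k : Goal Name Val).subst θ = .atom (factAtom p (tuple θ k)) := by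
  rw [subst_varGoal, tuple, List.range_eq_range']

theorem tuple_add (θ : ℕ → Val) (m n : ℕ) :
    tuple θ (m + n) = tuple θ m ++ (List.range' m n).map θ := by
  rw [tuple, List.range_eq_range', ← List.range'_append_1, List.map_append, tuple,
    List.range_eq_range']
  simp

theorem Expr.subst_toTerm [Inhabited Val] {k : ℕ} {e : Expr Val} (he : e.WF k) (θ : ℕ → Val) :
    e.toTerm.subst θ = .const (e.eval (tuple θ k)) := by
  cases e with
  | col i =>
    have hi : i < k := he
    simp [Expr.toTerm, Term.subst, Expr.eval, tuple, hi]
  | lit c => rfl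

theorem map_subst_toTerm [Inhabited Val] {k : ℕ} {es : List (Expr Val)} (h : ∀ e ∈ es, e.WF k)
    (θ : ℕ → Val) :
    (es.map Expr.toTerm).map (Term.subst θ) = (es.map (Expr.eval (tuple θ k))).map .const := by
  simp only [List.map_map]
  exact List.map_congr_left fun e he => Expr.subst_toTerm (h e he) θ

theorem subst_exprAtom [Inhabited Val] {k : ℕ} {es : List (Expr Val)} (h : ∀ e ∈ es, e.WF k)
    (θ : ℕ → Val) (r : Name) :
    (⟨r, es.map Expr.toTerm⟩ : Atom Name Val).subst θ =
      factAtom r (es.map (Expr.eval (tuple θ k))) := by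
  simp only [Atom.subst, factAtom, map_subst_toTerm h]

/-- The instances of the goals `Gs` are determined by the values of the first `k` variables. -/
def DependsOn (k : ℕ) (Gs : List (Goal Name Val)) : Prop :=
  ∀ θ θ' : ℕ → Val, tuple θ k = tuple θ' k → Gs.map (Goal.subst θ) = Gs.map (Goal.subst θ')

open Classical in
theorem count_project_selection [Inhabited Val] [LinearOrder Val] (es : List (Expr Val))
    (S : Set (List Val)) (M : Multiset (List Val)) (t : List Val) :
    (project es (selection (fun x => x ∈ S) M)).count t =
      ∑ x ∈ M.toFinset with es.map (Expr.eval x) = t ∧ x ∈ S, M.count x := by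
  rw [project, selection, Multiset.count_map, ← Multiset.toFinset_sum_count_eq,
    Multiset.filter_filter]
  refine Finset.sum_congr ?_ ?_
  · ext x
    simp [eq_comm]
  · intro x hx
    rw [Multiset.count_filter_of_pos]
    simpa [eq_comm] using (Finset.mem_filter.1 hx).2

section Guarded

variable [LinearOrder Val] {σ : Name → ℕ}

theorem mult_ne_zero_iff {P : Program Name Val} {G : Goal Name Val} :
    mult σ P G ≠ 0 ↔ ∃ i, Der σ P i G :=
  Set.encard_ne_zero

/-- A rule whose body consists of goals that range over the multiset `M`, and of goals that test
for the membership in `S`. -/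
theorem ways_guarded [Inhabited Val] {P : Program Name Val} {k : ℕ} {es : List (Expr Val)}
    {guard tests : List (Goal Name Val)} {M : Multiset (List Val)} {S : Set (List Val)}
    {r : Name} {t : List Val} (hes : ∀ e ∈ es, e.WF k) (hlen : ∀ x ∈ M, x.length = k)
    (hguard : ∀ θ θ' : ℕ → Val,
      guard.map (Goal.subst θ) = guard.map (Goal.subst θ') ↔ tuple θ k = tuple θ' k)
    (htests : DependsOn k tests)
    (hM : ∀ θ, (wit σ P (guard.map (Goal.subst θ))).encard = M.count (tuple θ k))
    (hone : ∀ G ∈ tests, ∀ θ, mult σ P (G.subst θ) ≤ 1)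
    (hS : ∀ θ, (∀ G ∈ guard, ∃ i, Der σ P i (G.subst θ)) →
      ((∀ G ∈ tests, ∃ i, Der σ P i (G.subst θ)) ↔ tuple θ k ∈ S)) :
    ways σ P (factAtom r t) (.mk ⟨r, es.map Expr.toTerm⟩ (guard ++ tests)) =
      ((project es (selection (fun x => x ∈ S) M)).count t : ℕ∞) := by
  classical
  set τ : List Val → ℕ → Val := fun x i => x.getD i default with hτ
  have hmem : ∀ θ, (∀ G ∈ guard, ∃ i, Der σ P i (G.subst θ)) ↔ tuple θ k ∈ M := by
    intro θ
    rw [← Multiset.count_pos, ← Nat.cast_pos (α := ℕ∞), ← hM, Set.encard_pos, wit_nonempty_iff]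
    simp
  have hset : applications σ P (.mk ⟨r, es.map Expr.toTerm⟩ (guard ++ tests)) (factAtom r t) =
      ⋃ x ∈ M.toFinset.filter (fun x => es.map (Expr.eval x) = t ∧ x ∈ S),
        wit σ P ((guard ++ tests).map (Goal.subst (τ x))) := by
    ext l
    simp only [applications, Set.mem_ofPred_eq, Set.mem_iUnion, Finset.mem_filter,
      Multiset.mem_toFinset, Rule.head, Rule.body, exists_prop, subst_exprAtom hes, factAtom_inj,
      true_and]
    constructor
    · rintro ⟨θ, ht, hl⟩
      have hd := wit_nonempty_iff.1 ⟨l, hl⟩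
      simp only [List.mem_map, List.mem_append, forall_exists_index, and_imp,
        forall_apply_eq_imp_iff₂] at hd
      have hx : tuple θ k ∈ M := (hmem θ).1 fun G hG => hd G (.inl hG)
      have heq : tuple (τ (tuple θ k)) k = tuple θ k := tuple_getD (hlen _ hx)
      refine ⟨tuple θ k, ⟨hx, ht, (hS θ ((hmem θ).2 hx)).1 fun G hG => hd G (.inr hG)⟩, ?_⟩
      rwa [List.map_append, (hguard _ θ).2 heq, htests _ θ heq, ← List.map_append]
    · rintro ⟨x, ⟨hx, ht, -⟩, hl⟩
      exact ⟨τ x, by rw [hτ, tuple_getD (hlen _ hx), ht], hl⟩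
  rw [ways, hset, encard_biUnion_finset, count_project_selection, Nat.cast_sum]
  · refine Finset.sum_congr rfl fun x hx => ?_
    obtain ⟨hx, -, hxS⟩ := by simpa using hx
    have heq : tuple (τ x) k = x := tuple_getD (hlen _ hx)
    rw [List.map_append, encard_wit_append, hM, heq, encard_wit_of_mult_le_one, if_pos, mul_one]
    · simp only [List.mem_map, forall_exists_index, and_imp, forall_apply_eq_imp_iff₂]
      refine (hS _ ((hmem _).2 ?_)).2 ?_ <;> rwa [heq]
    · simp only [List.mem_map, forall_exists_index, and_imp, forall_apply_eq_imp_iff₂]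
      exact fun G hG => hone G hG _
  · intro x hx y hy hne
    rw [Set.disjoint_left]
    rintro l ⟨h1, -⟩ ⟨h2, -⟩
    have h3 := h1.symm.trans h2
    rw [List.map_append, List.map_append] at h3
    have h4 := (hguard _ _).1 (List.append_inj_left h3 (by simp))
    obtain ⟨hx, -⟩ := by simpa using hx
    obtain ⟨hy, -⟩ := by simpa using hy
    rw [hτ, tuple_getD (hlen _ hx), tuple_getD (hlen _ hy)] at h4
    exact hne h4

end Guarded

/-! ## Rules that define a set of predicates -/

/-- The rules of `P` for the predicates in `F` are those of `L`. -/
def Owns (P : Program Name Val) (L : List (Rule Name Val)) (F : Set Name) : Prop :=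
  ∃ Y : Program Name Val, P = (L : Program Name Val) + Y ∧ ∀ R ∈ Y, R.head.pred ∉ F

namespace Owns

variable {P : Program Name Val} {L A B : List (Rule Name Val)} {F F' : Set Name}

theorem part (h : Owns P L F) (B : List (Rule Name Val))
    (hL : (L : Program Name Val) = (A : Program Name Val) + (B : Program Name Val))
    (hF : F' ⊆ F) (hB : ∀ R ∈ B, R.head.pred ∉ F') : Owns P A F' := by
  obtain ⟨Y, rfl, hY⟩ := h
  refine ⟨B + Y, by rw [hL, add_assoc], fun R hR => ?_⟩
  rcases Multiset.mem_add.1 hR with h | h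
  · exact hB R (Multiset.mem_coe.1 h)
  · exact fun hF' => hY R h (hF hF')

theorem add (h : Owns P L F) {X : Program Name Val} (hX : ∀ R ∈ X, R.head.pred ∉ F) :
    Owns (P + X) L F := by
  obtain ⟨Y, rfl, hY⟩ := h
  refine ⟨Y + X, by rw [add_assoc], fun R hR => ?_⟩
  rcases Multiset.mem_add.1 hR with h | h
  · exact hY R h
  · exact hX R h

variable [LinearOrder Val] {σ : Name → ℕ}

theorem mult_eq (h : Owns P L F) {A : Atom Name Val} (hA : A.pred ∈ F) :
    mult σ P (.atom A) = (L.map (ways σ P A)).sum := by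
  obtain ⟨Y, hP, hY⟩ := h
  rw [mult_atom, hP, Multiset.map_add, Multiset.sum_add, ← hP,
    sum_ways_eq_zero (L := Y) fun R hR he => hY R hR (he ▸ hA), add_zero, Multiset.map_coe,
    Multiset.sum_coe]

theorem exists_der_iff (h : Owns P L F) {A : Atom Name Val} (hA : A.pred ∈ F) :
    (∃ i, Der σ P i (.atom A)) ↔ ∃ R ∈ L, ∃ θ : ℕ → Val, R.head.subst θ = A ∧
      ∀ G ∈ R.body, ∃ i, Der σ P i (G.subst θ) := by
  obtain ⟨Y, hP, hY⟩ := h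
  rw [exists_der_atom_iff]
  constructor
  · rintro ⟨R, hR, θ, rfl, h⟩
    rw [hP] at hR
    rcases Multiset.mem_add.1 hR with hR | hR
    · exact ⟨R, Multiset.mem_coe.1 hR, θ, rfl, h⟩
    · exact (hY R hR hA).elim
  · rintro ⟨R, hR, h⟩
    exact ⟨R, by rw [hP]; exact Multiset.mem_add.2 (.inl (Multiset.mem_coe.2 hR)), h⟩

end Owns

theorem sum_map_ways_eq_zero [LinearOrder Val] {σ : Name → ℕ} {P : Program Name Val}
    {A : Atom Name Val} {L : List (Rule Name Val)} (h : ∀ R ∈ L, R.head.pred ≠ A.pred) :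
    (L.map (ways σ P A)).sum = 0 := by
  simpa using sum_ways_eq_zero (σ := σ) (P := P) (L := (L : Program Name Val)) (by simpa using h)

/-! ## Predicates supplied for a part of the syntax tree -/

/-- The names supplied at the position `p` and below. -/
def under (g : List ℕ → Name) (p : List ℕ) : Set Name :=
  {x | ∃ q, p <+: q ∧ x = g q}

section Under

variable {g : List ℕ → Name} {p : List ℕ} {x : Name} {i j : ℕ}

theorem self_mem_under : g p ∈ under g p :=
  ⟨p, List.prefix_rfl, rfl⟩

theorem under_child_subset : under g (p ++ [i]) ⊆ under g p := by
  rintro _ ⟨q, hq, rfl⟩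
  exact ⟨q, (List.prefix_append _ _).trans hq, rfl⟩

theorem self_notMem_under_child (hg : Function.Injective g) : g p ∉ under g (p ++ [i]) := by
  rintro ⟨q, hq, he⟩
  obtain rfl := hg he
  simpa using hq.length_le

theorem notMem_under_of_ne (hg : Function.Injective g) (hij : i ≠ j)
    (h : x ∈ under g (p ++ [i])) : x ∉ under g (p ++ [j]) := by
  obtain ⟨q, ⟨l, rfl⟩, rfl⟩ := h
  rintro ⟨q', ⟨l', rfl⟩, he⟩
  have := hg he
  simp only [List.append_assoc, List.append_cancel_left_eq, List.cons_append, List.nil_append,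
    List.cons.injEq] at this
  exact hij this.1

end Under

section Heads

variable [DecidableEq Name] {g : List ℕ → Name}

mutual

theorem Query.head_toDL : ∀ (Q : Query Name Val) {Γ : Scope Name} {p : List ℕ} {r : Name}
    {R : Rule Name Val}, R ∈ Q.toDL g Γ p r → R.head.pred = r ∨ R.head.pred ∈ under g p
  | .values cs => by
    intro h
    rw [Query.toDL, List.mem_singleton] at h
    exact .inl (by rw [h]; rfl)
  | .select es S c => by
    intro h
    simp only [Query.toDL, List.mem_cons, List.mem_append] at h
    rcases h with rfl | h | h
    · exact .inl rfl
    · exact .inr (under_child_subset (S.head_toDL h))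
    · exact .inr (under_child_subset (c.head_toDL h))
  | .unionAll Q₁ Q₂ => by
    intro h
    simp only [Query.toDL, List.mem_append] at h
    rcases h with h | h
    · exact (Q₁.head_toDL h).imp id fun h => under_child_subset h
    · exact (Q₂.head_toDL h).imp id fun h => under_child_subset h
  | .withViews vs Q => by
    intro h
    simp only [Query.toDL, List.mem_cons] at h
    rcases h with rfl | h
    · exact .inl rfl
    · rcases Q.head_toDL h with h | h
      · exact .inr (h ▸ self_mem_under)
      · exact .inr (under_child_subset h)

theorem SqlRel.head_toDL : ∀ (S : SqlRel Name Val) {Γ : Scope Name} {p : List ℕ}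
    {R : Rule Name Val}, R ∈ (S.toDL g Γ p).2 → R.head.pred ∈ under g p
  | .name _ => by
    intro h
    simp [SqlRel.toDL] at h
  | .stmt Q => by
    intro h
    simp only [SqlRel.toDL] at h
    rcases Q.head_toDL h with h | h
    · exact h ▸ self_mem_under
    · exact under_child_subset h
  | .join S₁ S₂ c => by
    intro h
    simp only [SqlRel.toDL, List.mem_cons, List.mem_append] at h
    rcases h with rfl | (h | h) | h
    · exact self_mem_under
    · exact under_child_subset (S₁.head_toDL h)
    · exact under_child_subset (S₂.head_toDL h)
    · exact under_child_subset (c.head_toDL h)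

theorem Cond.head_toDL : ∀ (c : Cond Name Val) {Γ : Scope Name} {p : List ℕ}
    {guard : List (Goal Name Val)} {k : ℕ} {R : Rule Name Val},
    R ∈ (c.toDL g Γ p guard k).2 → R.head.pred ∈ under g p
  | .tt => by
    intro h
    simp [Cond.toDL] at h
  | .cmp _ _ _ => by
    intro h
    simp [Cond.toDL] at h
  | .isIn _ S => by
    intro h
    simp only [Cond.toDL] at h
    exact under_child_subset (S.head_toDL h)
  | .notIn _ S => by
    intro h
    simp only [Cond.toDL] at h
    exact under_child_subset (S.head_toDL h)
  | .exist S => by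
    intro h
    simp only [Cond.toDL, List.mem_cons] at h
    rcases h with rfl | h
    · exact self_mem_under
    · exact under_child_subset (S.head_toDL h)
  | .and c₁ c₂ => by
    intro h
    simp only [Cond.toDL, List.mem_append] at h
    rcases h with h | h
    · exact under_child_subset (c₁.head_toDL h)
    · exact under_child_subset (c₂.head_toDL h)
  | .or c₁ c₂ => by
    intro h
    simp only [Cond.toDL, List.mem_cons, List.mem_append] at h
    rcases h with rfl | rfl | h | h
    · exact self_mem_under
    · exact self_mem_under
    · exact under_child_subset (c₁.head_toDL h)
    · exact under_child_subset (c₂.head_toDL h)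
  | .not c => by
    intro h
    simp only [Cond.toDL, List.mem_cons] at h
    rcases h with rfl | h
    · exact self_mem_under
    · exact under_child_subset (c.head_toDL h)

theorem Views.head_toDL : ∀ (vs : Views Name Val) {Γ : Scope Name} {p : List ℕ}
    {R : Rule Name Val}, R ∈ vs.toDL g Γ p → R.head.pred ∈ vs.names ∨ R.head.pred ∈ under g p
  | .nil => by
    intro h
    simp [Views.toDL] at h
  | .cons r Q vs => by
    intro h
    simp only [Views.toDL, List.mem_append] at h
    rcases h with h | h
    · rcases Q.head_toDL h with h | h
      · exact .inl (by simp [Views.names, h])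
      · exact .inr (under_child_subset h)
    · rcases vs.head_toDL h with h | h
      · exact .inl (by simp [Views.names, h])
      · exact .inr (under_child_subset h)

end

end Heads

/-! ## Goals of conditions -/

/-- Comparisons, and negations of goals that assume nothing. -/
def Goal.IsTest : Goal Name Val → Prop
  | .cmp _ _ _ => True
  | .neg G => G.assumed = []
  | _ => False

theorem Goal.IsTest.assumed_eq {G : Goal Name Val} (h : G.IsTest) : G.assumed = [] := by
  cases G with
  | cmp => rfl
  | neg G => exact h
  | atom => exact h.elim
  | imp => exact h.elim

theorem Goal.IsTest.mult_le_one [LinearOrder Val] {σ : Name → ℕ} {P₀ P : Program Name Val}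
    (hσ : IsStratification σ P₀) (hP : ∀ R ∈ P, Occurs P₀ R) {G : Goal Name Val} (h : G.IsTest)
    (θ : ℕ → Val) : mult σ P (G.subst θ) ≤ 1 := by
  rw [mult, Set.encard_le_one_iff]
  intro a b ha hb
  cases G with
  | cmp op s t =>
    cases s <;> cases t <;> exact (der_cmp_iff.1 ha).1.trans (der_cmp_iff.1 hb).1.symm
  | neg G =>
    have hG : ∀ R ∈ (G.subst θ).assumed, Occurs P₀ R := by
      have h' : G.assumed = [] := h
      simp [h']
    exact ((der_neg_iff hσ hP hG).1 ha).1.trans ((der_neg_iff hσ hP hG).1 hb).1.symm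
  | atom => exact h.elim
  | imp => exact h.elim

theorem DependsOn.append {k : ℕ} {Gs Gs' : List (Goal Name Val)} (h : DependsOn k Gs)
    (h' : DependsOn k Gs') : DependsOn k (Gs ++ Gs') := by
  intro θ θ' he
  rw [List.map_append, List.map_append, h _ _ he, h' _ _ he]

theorem dependsOn_varGoal (p : Name) (k : ℕ) : DependsOn k [(varGoal p 0 k : Goal Name Val)] := by
  intro θ θ' he
  simp [subst_varGoal_zero, he]

section Tests

variable [DecidableEq Name] {g : List ℕ → Name}

theorem Cond.isTest_toDL : ∀ (c : Cond Name Val) {Γ : Scope Name} {p : List ℕ}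
    {guard : List (Goal Name Val)} {k : ℕ}, ∀ G ∈ (c.toDL g Γ p guard k).1, G.IsTest
  | .tt => by simp [Cond.toDL]
  | .cmp _ _ _ => by simp [Cond.toDL, Goal.IsTest]
  | .isIn _ _ => by simp [Cond.toDL, Goal.IsTest, Goal.assumed]
  | .notIn _ _ => by simp [Cond.toDL, Goal.IsTest, Goal.assumed]
  | .exist _ => by simp [Cond.toDL, Goal.IsTest, Goal.assumed, varGoal]
  | .and c₁ c₂ => by
    intro G h
    simp only [Cond.toDL, List.mem_append] at h
    rcases h with h | h
    · exact c₁.isTest_toDL _ h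
    · exact c₂.isTest_toDL _ h
  | .or _ _ => by simp [Cond.toDL, Goal.IsTest, Goal.assumed, varGoal]
  | .not _ => by simp [Cond.toDL, Goal.IsTest, Goal.assumed, varGoal]

theorem Cond.dependsOn_toDL [Inhabited Val] : ∀ (c : Cond Name Val) {Γ : Scope Name}
    {p : List ℕ} {guard : List (Goal Name Val)} {k : ℕ}, c.WF Γ k →
    DependsOn k (c.toDL g Γ p guard k).1
  | .tt => by
    intro h θ θ' he
    simp [Cond.toDL]
  | .cmp _ _ _ => by
    intro h θ θ' he
    simp only [Cond.WF] at h
    simp [Cond.toDL, Goal.subst, Expr.subst_toTerm h.1, Expr.subst_toTerm h.2, he]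
  | .isIn _ _ => by
    intro h θ θ' he
    simp only [Cond.WF] at h
    simp [Cond.toDL, Goal.subst, subst_exprAtom h.1, he]
  | .notIn _ _ => by
    intro h θ θ' he
    simp only [Cond.WF] at h
    simp [Cond.toDL, Goal.subst, subst_exprAtom h.1, he]
  | .exist _ => by
    intro h θ θ' he
    simp [Cond.toDL, Goal.subst, subst_varGoal_zero, tuple]
  | .and c₁ c₂ => by
    intro h
    simp only [Cond.WF] at h
    simp only [Cond.toDL]
    exact (c₁.dependsOn_toDL h.1).append (c₂.dependsOn_toDL h.2)
  | .or _ _ => by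
    intro h θ θ' he
    simp [Cond.toDL, Goal.subst, subst_varGoal_zero, he]
  | .not _ => by
    intro h θ θ' he
    simp [Cond.toDL, Goal.subst, subst_varGoal_zero, he]

end Tests

/-! ## Degrees and scopes -/

theorem length_of_mem_project [Inhabited Val] {es : List (Expr Val)} {m : Multiset (List Val)}
    {t : List Val} (h : t ∈ project es m) : t.length = es.length := by
  obtain ⟨x, -, rfl⟩ := Multiset.mem_map.1 h
  simp

open Classical in
theorem mem_of_mem_selection {p : List Val → Prop} {m : Multiset (List Val)} {t : List Val}
    (h : t ∈ selection p m) : t ∈ m :=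
  (Multiset.mem_filter.1 h).1

section Degrees

variable [DecidableEq Name] [Inhabited Val] [LinearOrder Val]

/-- The instances `ρ` of the visible relations fit the scope. -/
def Fits (Γ : Scope Name) (ρ : Name → Multiset (List Val)) : Prop :=
  ∀ T d, Γ T = some d → ∀ t ∈ ρ T, t.length = d

mutual

theorem Query.length_of_mem_eval : ∀ (Q : Query Name Val) {Γ : Scope Name}
    {ρ : Name → Multiset (List Val)}, Fits Γ ρ → Q.WF Γ → ∀ t ∈ Q.eval ρ, t.length = Q.degree
  | .values cs => by
    intro hρ hQ t ht
    rw [Query.eval, Multiset.mem_singleton] at ht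
    rw [ht, Query.degree]
  | .select es R c => by
    intro hρ hQ t ht
    rw [Query.eval] at ht
    exact length_of_mem_project ht
  | .unionAll Q₁ Q₂ => by
    intro hρ hQ t ht
    rw [Query.WF] at hQ
    rw [Query.eval] at ht
    rcases Multiset.mem_add.1 ht with ht | ht
    · exact Q₁.length_of_mem_eval hρ hQ.1 t ht
    · exact (Q₂.length_of_mem_eval hρ hQ.2.1 t ht).trans hQ.2.2.symm
  | .withViews vs Q => by
    intro hρ hQ t ht
    rw [Query.WF] at hQ
    rw [Query.eval] at ht
    exact Q.length_of_mem_eval (vs.fits_eval hρ hQ.2.2.2.1) hQ.2.2.2.2 t ht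

theorem SqlRel.length_of_mem_eval : ∀ (S : SqlRel Name Val) {Γ : Scope Name}
    {ρ : Name → Multiset (List Val)}, Fits Γ ρ → S.WF Γ → ∀ t ∈ S.eval ρ, t.length = S.degree Γ
  | .name T => by
    intro hρ hS t ht
    rw [SqlRel.WF] at hS
    rw [SqlRel.eval] at ht
    obtain ⟨d, hd⟩ := Option.isSome_iff_exists.1 hS
    rw [SqlRel.degree, hd]
    exact hρ T d hd t ht
  | .stmt Q => by
    intro hρ hS t ht
    rw [SqlRel.WF] at hS
    rw [SqlRel.eval] at ht
    exact Q.length_of_mem_eval hρ hS t ht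
  | .join S₁ S₂ c => by
    intro hρ hS t ht
    rw [SqlRel.WF] at hS
    rw [SqlRel.eval] at ht
    obtain ⟨q, hq, rfl⟩ := Multiset.mem_map.1 (mem_of_mem_selection ht)
    obtain ⟨h1, h2⟩ := Multiset.mem_product.1 hq
    rw [List.length_append, S₁.length_of_mem_eval hρ hS.1 _ h1,
      S₂.length_of_mem_eval hρ hS.2.1 _ h2, SqlRel.degree]

theorem Views.fits_eval : ∀ (vs : Views Name Val) {Γ : Scope Name}
    {ρ : Name → Multiset (List Val)}, Fits Γ ρ → vs.WF Γ →
    Fits (vs.scope Γ) (fun x => vs.eval ρ x)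
  | .nil => by
    intro hρ hvs T d hd t ht
    simp only [Views.eval] at ht
    exact hρ T d hd t ht
  | .cons r Q vs => by
    intro hρ hvs T d hd t ht
    rw [Views.WF] at hvs
    simp only [Views.eval] at ht
    rw [Views.scope, Function.update_apply] at hd
    split_ifs at ht hd with h
    · rw [Q.length_of_mem_eval hρ hvs.1 t ht]
      simpa using hd
    · exact vs.fits_eval hρ hvs.2 T d hd t ht

end

end Degrees

theorem Views.scope_of_notMem [DecidableEq Name] {Γ : Scope Name} {x : Name} :
    ∀ {vs : Views Name Val}, x ∉ vs.names → vs.scope Γ x = Γ x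
  | .nil => fun _ => rfl
  | .cons r Q vs => by
    intro h
    simp only [Views.names, List.mem_cons, not_or] at h
    rw [Views.scope, Function.update_of_ne h.1, Views.scope_of_notMem h.2]

theorem Views.eval_of_notMem [DecidableEq Name] [Inhabited Val] [LinearOrder Val]
    {ρ : Name → Multiset (List Val)} {x : Name} :
    ∀ {vs : Views Name Val}, x ∉ vs.names → vs.eval ρ x = ρ x
  | .nil => fun _ => by rw [Views.eval]
  | .cons r Q vs => by
    intro h
    simp only [Views.names, List.mem_cons, not_or] at h
    rw [Views.eval, if_neg h.1, Views.eval_of_notMem h.2]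

theorem Views.none_of_scope_eq_none [DecidableEq Name] {Γ : Scope Name} {x : Name} :
    ∀ {vs : Views Name Val}, vs.scope Γ x = none → Γ x = none
  | .nil => id
  | .cons r Q vs => by
    intro h
    rw [Views.scope, Function.update_apply] at h
    split_ifs at h
    exact Views.none_of_scope_eq_none h

section Declared

variable [DecidableEq Name] {x : Name}

mutual

/-- Declared names are not visible in the scope of a well-formed statement. -/
theorem Query.scope_declared : ∀ (Q : Query Name Val) {Γ : Scope Name}, Q.WF Γ →
    x ∈ Q.declared → Γ x = none
  | .values _ => by
    intro hQ h
    simp [Query.declared] at h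
  | .select es R c => by
    intro hQ h
    rw [Query.WF] at hQ
    rw [Query.declared, List.mem_append] at h
    rcases h with h | h
    · exact R.scope_declared hQ.1 h
    · exact c.scope_declared hQ.2.2 h
  | .unionAll Q₁ Q₂ => by
    intro hQ h
    rw [Query.WF] at hQ
    rw [Query.declared, List.mem_append] at h
    rcases h with h | h
    · exact Q₁.scope_declared hQ.1 h
    · exact Q₂.scope_declared hQ.2.1 h
  | .withViews vs Q => by
    intro hQ h
    rw [Query.WF] at hQ
    rw [Query.declared, List.mem_append, List.mem_append] at h
    rcases h with (h | h) | h
    · exact (hQ.2.1 x h).1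
    · exact vs.scope_declared hQ.2.2.2.1 h
    · exact Views.none_of_scope_eq_none (Q.scope_declared hQ.2.2.2.2 h)

theorem SqlRel.scope_declared : ∀ (S : SqlRel Name Val) {Γ : Scope Name}, S.WF Γ →
    x ∈ S.declared → Γ x = none
  | .name _ => by
    intro hS h
    simp [SqlRel.declared] at h
  | .stmt Q => by
    intro hS h
    rw [SqlRel.WF] at hS
    rw [SqlRel.declared] at h
    exact Q.scope_declared hS h
  | .join S₁ S₂ c => by
    intro hS h
    rw [SqlRel.WF] at hS
    rw [SqlRel.declared, List.mem_append, List.mem_append] at h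
    rcases h with (h | h) | h
    · exact S₁.scope_declared hS.1 h
    · exact S₂.scope_declared hS.2.1 h
    · exact c.scope_declared hS.2.2 h

theorem Cond.scope_declared : ∀ (c : Cond Name Val) {Γ : Scope Name} {k : ℕ}, c.WF Γ k →
    x ∈ c.declared → Γ x = none
  | .tt => by
    intro hc h
    simp [Cond.declared] at h
  | .cmp _ _ _ => by
    intro hc h
    simp [Cond.declared] at h
  | .isIn _ S => by
    intro hc h
    rw [Cond.WF] at hc
    rw [Cond.declared] at h
    exact S.scope_declared hc.2.1 h
  | .notIn _ S => by
    intro hc h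
    rw [Cond.WF] at hc
    rw [Cond.declared] at h
    exact S.scope_declared hc.2.1 h
  | .exist S => by
    intro hc h
    rw [Cond.WF] at hc
    rw [Cond.declared] at h
    exact S.scope_declared hc h
  | .and c₁ c₂ => by
    intro hc h
    rw [Cond.WF] at hc
    rw [Cond.declared, List.mem_append] at h
    rcases h with h | h
    · exact c₁.scope_declared hc.1 h
    · exact c₂.scope_declared hc.2 h
  | .or c₁ c₂ => by
    intro hc h
    rw [Cond.WF] at hc
    rw [Cond.declared, List.mem_append] at h
    rcases h with h | h
    · exact c₁.scope_declared hc.1 h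
    · exact c₂.scope_declared hc.2 h
  | .not c => by
    intro hc h
    rw [Cond.WF] at hc
    rw [Cond.declared] at h
    exact c.scope_declared hc h

theorem Views.scope_declared : ∀ (vs : Views Name Val) {Γ : Scope Name}, vs.WF Γ →
    x ∈ vs.declared → Γ x = none
  | .nil => by
    intro hvs h
    simp [Views.declared] at h
  | .cons _ Q vs => by
    intro hvs h
    rw [Views.WF] at hvs
    rw [Views.declared, List.mem_append] at h
    rcases h with h | h
    · exact Q.scope_declared hvs.1 h
    · exact vs.scope_declared hvs.2 h

end

end Declared

/-! ## Correctness of the translation -/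

theorem project_cols [Inhabited Val] {k : ℕ} {M : Multiset (List Val)}
    (h : ∀ x ∈ M, x.length = k) : project ((List.range k).map Expr.col) M = M := by
  conv_rhs => rw [← Multiset.map_id' M]
  refine Multiset.map_congr rfl fun x hx => ?_
  rw [List.map_map]
  exact tuple_getD (h x hx)

theorem varsFrom_eq_map_toTerm (k : ℕ) :
    (varsFrom 0 k : List (Term Val)) = ((List.range k).map Expr.col).map Expr.toTerm := by
  rw [varsFrom, List.range_eq_range', List.map_map]
  rfl

theorem selection_univ (M : Multiset (List Val)) : selection (fun x => x ∈ Set.univ) M = M := by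
  simp [selection]

theorem count_product [DecidableEq Val] {M₁ M₂ : Multiset (List Val)} {a b : List Val}
    (h : ∀ x ∈ M₁, x.length = a.length) :
    (product M₁ M₂).count (a ++ b) = M₁.count a * M₂.count b := by
  have h1 : (product M₁ M₂).count (a ++ b) = (M₁ ×ˢ M₂).count (a, b) := by
    rw [product, Multiset.count_map, Multiset.count_eq_card_filter_eq]
    congr 1
    refine Multiset.filter_congr fun q hq => ?_
    obtain ⟨hq, -⟩ := Multiset.mem_product.1 hq
    constructor
    · intro he
      obtain ⟨h1, h2⟩ := List.append_inj he (h _ hq).symm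
      exact Prod.ext h1 h2
    · rintro h
      rw [← h]
  rw [h1]
  clear h h1
  induction M₁ using Multiset.induction_on with
  | empty => simp
  | cons x M₁ ih =>
    rw [Multiset.cons_product, Multiset.count_add, ih, Multiset.count_cons, add_mul, add_comm]
    congr 1
    split_ifs with hx
    · rw [hx, one_mul, Multiset.count_map_eq_count' _ _ (Prod.mk_right_injective x)]
    · rw [zero_mul, Multiset.count_eq_zero]
      rintro hmem
      obtain ⟨y, -, hy⟩ := Multiset.mem_map.1 hmem
      exact hx (congrArg Prod.fst hy).symm

section Correctness

variable [LinearOrder Val] {σ : Name → ℕ} {P₀ : Program Name Val}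

theorem ways_guarded_vars [Inhabited Val] {P : Program Name Val} {k : ℕ}
    {guard tests : List (Goal Name Val)} {M : Multiset (List Val)} {S : Set (List Val)}
    {r : Name} {t : List Val} (hlen : ∀ x ∈ M, x.length = k)
    (hguard : ∀ θ θ' : ℕ → Val,
      guard.map (Goal.subst θ) = guard.map (Goal.subst θ') ↔ tuple θ k = tuple θ' k)
    (htests : DependsOn k tests)
    (hM : ∀ θ, (wit σ P (guard.map (Goal.subst θ))).encard = M.count (tuple θ k))
    (hone : ∀ G ∈ tests, ∀ θ, mult σ P (G.subst θ) ≤ 1)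
    (hS : ∀ θ, (∀ G ∈ guard, ∃ i, Der σ P i (G.subst θ)) →
      ((∀ G ∈ tests, ∃ i, Der σ P i (G.subst θ)) ↔ tuple θ k ∈ S)) :
    ways σ P (factAtom r t) (.mk ⟨r, varsFrom 0 k⟩ (guard ++ tests)) =
      ((selection (fun x => x ∈ S) M).count t : ℕ∞) := by
  rw [varsFrom_eq_map_toTerm, ways_guarded _ hlen hguard htests hM hone hS, project_cols]
  · exact fun x hx => hlen x (mem_of_mem_selection hx)
  · intro e he
    obtain ⟨i, hi, rfl⟩ := List.mem_map.1 he
    exact List.mem_range.1 hi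

theorem encard_wit_singleton (P : Program Name Val) (G : Goal Name Val) :
    (wit σ P [G]).encard = mult σ P G := by
  rw [encard_wit_cons, wit_nil, Set.encard_singleton, mul_one]

theorem exists_der_neg_iff (hσ : IsStratification σ P₀) {P : Program Name Val}
    (hP : ∀ R ∈ P, Occurs P₀ R) {G : Goal Name Val} (hG : G.assumed = []) :
    (∃ i, Der σ P i (.neg G)) ↔ ¬ ∃ i, Der σ P i G := by
  simp [der_neg_iff hσ hP (G := G) (by simp [hG])]

theorem exists_der_neg_neg_iff (hσ : IsStratification σ P₀) {P : Program Name Val}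
    (hP : ∀ R ∈ P, Occurs P₀ R) {G : Goal Name Val} (hG : G.assumed = []) :
    (∃ i, Der σ P i (.neg (.neg G))) ↔ ∃ i, Der σ P i G := by
  rw [exists_der_neg_iff hσ hP (by simpa [Goal.assumed]), exists_der_neg_iff hσ hP hG, not_not]

/-- The rules of the translation of `OR` and `NOT`, when the guard holds. -/
theorem exists_subst_body_iff {P : Program Name Val} {k : ℕ} {q : Name}
    {guard tests : List (Goal Name Val)} (htests : DependsOn k tests)
    {θ : ℕ → Val} (hd : ∀ G ∈ guard, ∃ i, Der σ P i (G.subst θ)) :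
    (∃ θ' : ℕ → Val, (Rule.mk (⟨q, varsFrom 0 k⟩ : Atom Name Val) (guard ++ tests)).head.subst θ' =
        factAtom q (tuple θ k) ∧
      ∀ G ∈ (Rule.mk (⟨q, varsFrom 0 k⟩ : Atom Name Val) (guard ++ tests)).body,
        ∃ i, Der σ P i (G.subst θ')) ↔ ∀ G ∈ tests, ∃ i, Der σ P i (G.subst θ) := by
  simp only [Rule.head, Rule.body, subst_varAtom, factAtom_inj, true_and]
  have hcongr : ∀ {Gs : List (Goal Name Val)} {θ θ' : ℕ → Val}, DependsOn k Gs →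
      tuple θ k = tuple θ' k → (∀ G ∈ Gs, ∃ i, Der σ P i (G.subst θ)) →
      ∀ G ∈ Gs, ∃ i, Der σ P i (G.subst θ') := by
    intro Gs θ θ' hGs he h G hG
    have h1 : ∀ G' ∈ Gs.map (Goal.subst θ), ∃ i, Der σ P i G' := by simpa using h
    rw [hGs _ _ he] at h1
    exact h1 _ (List.mem_map_of_mem hG)
  constructor
  · rintro ⟨θ', he, h⟩
    exact hcongr htests he fun G hG => h G (List.mem_append_right _ hG)
  · intro h
    refine ⟨θ, rfl, fun G hG => ?_⟩
    rcases List.mem_append.1 hG with hG | hG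
    · exact hd G hG
    · exact h G hG

/-- The invariant under which a part of a statement, at the position `p` and with the declared
names `D`, is translated. In the database `P`, the names visible in the scope `Γ` have the
instances `ρ`; this is not affected by assumptions that do not define the names in `H`. -/
structure Represents (σ : Name → ℕ) (P₀ : Program Name Val) (g : List ℕ → Name)
    (P : Program Name Val) (Γ : Scope Name) (ρ : Name → Multiset (List Val)) (H : Set Name)
    (p : List ℕ) (D : List Name) : Prop where
  occurs : ∀ R ∈ P, Occurs P₀ R
  mult_eq : ∀ X : Program Name Val, (∀ R ∈ X, Occurs P₀ R) → (∀ R ∈ X, R.head.pred ∉ H) →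
    ∀ T, (Γ T).isSome → ∀ t, mult σ (P + X) (.atom (factAtom T t)) = ((ρ T).count t : ℕ∞)
  fits : Fits Γ ρ
  under_disjoint : ∀ x ∈ under g p, x ∉ H
  declared_disjoint : ∀ x ∈ D, x ∉ H
  declared_ne : ∀ x ∈ D, ∀ q, x ≠ g q
  declared_new : ∀ x ∈ D, ∀ R ∈ P, R.head.pred ≠ x

variable {g : List ℕ → Name}

theorem Represents.child {P : Program Name Val} {Γ : Scope Name}
    {ρ : Name → Multiset (List Val)} {H : Set Name} {p : List ℕ} {D D' : List Name}
    (h : Represents σ P₀ g P Γ ρ H p D) (i : ℕ) (hD : D' ⊆ D) :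
    Represents σ P₀ g P Γ ρ H (p ++ [i]) D' where
  occurs := h.occurs
  mult_eq := h.mult_eq
  fits := h.fits
  under_disjoint := fun x hx => h.under_disjoint x (under_child_subset hx)
  declared_disjoint := fun x hx => h.declared_disjoint x (hD hx)
  declared_ne := fun x hx => h.declared_ne x (hD hx)
  declared_new := fun x hx => h.declared_new x (hD hx)

variable [DecidableEq Name] [Inhabited Val]

/-- The translation of the views of a `WITH` clause, and that of its main statement. -/
theorem Represents.views {P : Program Name Val} {Γ : Scope Name}
    {ρ : Name → Multiset (List Val)} {H : Set Name} {p : List ℕ} {vs : Views Name Val}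
    {Q : Query Name Val}
    (h : Represents σ P₀ g P Γ ρ H p (Query.withViews vs Q).declared)
    (hg : Function.Injective g) (hwf : (Query.withViews vs Q).WF Γ)
    (hV : ∀ R ∈ vs.toDL g Γ (p ++ [0]), Occurs P₀ R)
    (hP : ∀ R ∈ P, R.head.pred ∉ under g (p ++ [0]))
    (ih : ∀ {P' : Program Name Val}, Represents σ P₀ g P' Γ ρ H (p ++ [0]) vs.declared →
      Owns P' (vs.toDL g Γ (p ++ [0])) (under g (p ++ [0])) →
      ∀ x ∈ vs.names, ∀ t, ((vs.toDL g Γ (p ++ [0])).map (ways σ P' (factAtom x t))).sum =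
        ((vs.eval ρ x).count t : ℕ∞)) :
    Represents σ P₀ g (P + (vs.toDL g Γ (p ++ [0]) : List (Rule Name Val))) (vs.scope Γ)
      (fun x => vs.eval ρ x)
      (H ∪ {x | x ∈ vs.names} ∪ {x | x ∈ vs.declared} ∪ under g (p ++ [0]))
      (p ++ [1]) Q.declared := by
  have hsub : ∀ x, x ∈ vs.names ∨ x ∈ vs.declared ∨ x ∈ Q.declared →
      x ∈ (Query.withViews vs Q).declared := by
    intro x hx
    simp only [Query.declared, List.mem_append]
    tauto
  rw [Query.WF] at hwf
  obtain ⟨hnd, hn, hdd, hvs, hQ⟩ := hwf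
  have hVH : ∀ R ∈ (vs.toDL g Γ (p ++ [0]) : Program Name Val), R.head.pred ∉ H := by
    intro R hR
    rcases vs.head_toDL (Multiset.mem_coe.1 hR) with h' | h'
    · exact h.declared_disjoint _ (hsub _ (.inl h'))
    · exact h.under_disjoint _ (under_child_subset h')
  have hVocc : ∀ R ∈ (vs.toDL g Γ (p ++ [0]) : Program Name Val), Occurs P₀ R :=
    fun R hR => hV R (Multiset.mem_coe.1 hR)
  refine ⟨?_, ?_, vs.fits_eval h.fits hvs, ?_, ?_, ?_, ?_⟩
  · intro R hR
    rcases Multiset.mem_add.1 hR with hR | hR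
    exacts [h.occurs R hR, hVocc R hR]
  · intro X hX hXH T hT t
    simp only [Set.mem_union, Set.mem_ofPred_eq, not_or] at hXH
    have hX' : ∀ R ∈ (vs.toDL g Γ (p ++ [0]) : Program Name Val) + X,
        Occurs P₀ R ∧ R.head.pred ∉ H := by
      intro R hR
      rcases Multiset.mem_add.1 hR with hR | hR
      exacts [⟨hVocc R hR, hVH R hR⟩, ⟨hX R hR, (hXH R hR).1.1.1⟩]
    by_cases hTn : T ∈ vs.names
    · have hown : Owns (P + (vs.toDL g Γ (p ++ [0]) : Program Name Val) + X)
          (vs.toDL g Γ (p ++ [0])) (under g (p ++ [0]) ∪ {x | x ∈ vs.names}) := by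
        refine ⟨P + X, by abel, fun R hR => ?_⟩
        simp only [Set.mem_union, Set.mem_ofPred_eq, not_or]
        rcases Multiset.mem_add.1 hR with hR | hR
        · exact ⟨hP R hR, fun hx => h.declared_new _ (hsub _ (.inl hx)) R hR rfl⟩
        · exact ⟨(hXH R hR).2, (hXH R hR).1.1.2⟩
      rw [hown.mult_eq (A := factAtom T t) (.inr hTn)]
      refine ih ⟨?_, ?_, h.fits, fun x hx => h.under_disjoint x (under_child_subset hx),
        fun x hx => h.declared_disjoint x (hsub x (.inr (.inl hx))),
        fun x hx => h.declared_ne x (hsub x (.inr (.inl hx))), ?_⟩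
        (hown.part [] (by simp) Set.subset_union_left (by simp)) T hTn t
      · intro R hR
        rw [add_assoc] at hR
        rcases Multiset.mem_add.1 hR with hR | hR
        exacts [h.occurs R hR, (hX' R hR).1]
      · intro Y hY hYH
        rw [add_assoc P, add_assoc P]
        refine h.mult_eq _ ?_ ?_
        · intro R hR
          rcases Multiset.mem_add.1 hR with hR | hR
          exacts [(hX' R hR).1, hY R hR]
        · intro R hR
          rcases Multiset.mem_add.1 hR with hR | hR
          exacts [(hX' R hR).2, hYH R hR]
      · rintro x hx R hR rfl
        rw [add_assoc] at hR
        rcases Multiset.mem_add.1 hR with hR | hR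
        · exact h.declared_new _ (hsub _ (.inr (.inl hx))) R hR rfl
        rcases Multiset.mem_add.1 hR with hR | hR
        · rcases vs.head_toDL (Multiset.mem_coe.1 hR) with h' | ⟨q, -, h'⟩
          · exact (hn _ h').2.1 hx
          · exact h.declared_ne _ (hsub _ (.inr (.inl hx))) q h'
        · exact (hXH R hR).1.2 hx
    · rw [Views.scope_of_notMem hTn] at hT
      rw [Views.eval_of_notMem hTn, add_assoc]
      exact h.mult_eq _ (fun R hR => (hX' R hR).1) (fun R hR => (hX' R hR).2) T hT t
  · rintro x hx (((h' | h') | h') | h')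
    · exact h.under_disjoint x (under_child_subset hx) h'
    · obtain ⟨q, -, rfl⟩ := hx
      exact h.declared_ne _ (hsub _ (.inl h')) q rfl
    · obtain ⟨q, -, rfl⟩ := hx
      exact h.declared_ne _ (hsub _ (.inr (.inl h'))) q rfl
    · exact notMem_under_of_ne hg one_ne_zero hx h'
  · rintro x hx (((h' | h') | h') | h')
    · exact h.declared_disjoint x (hsub x (.inr (.inr hx))) h'
    · exact (hn _ h').2.2 hx
    · exact hdd _ h' hx
    · obtain ⟨q, -, rfl⟩ := h'
      exact h.declared_ne _ (hsub _ (.inr (.inr hx))) q rfl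
  · exact fun x hx => h.declared_ne x (hsub x (.inr (.inr hx)))
  · rintro x hx R hR rfl
    rcases Multiset.mem_add.1 hR with hR | hR
    · exact h.declared_new _ (hsub _ (.inr (.inr hx))) R hR rfl
    · rcases vs.head_toDL (Multiset.mem_coe.1 hR) with h' | ⟨q, -, h'⟩
      · exact (hn _ h').2.2 hx
      · exact h.declared_ne _ (hsub _ (.inr (.inr hx))) q h'

end Correctness

theorem factAtom_subst (θ : ℕ → Val) (r : Name) (t : List Val) :
    (factAtom r t).subst θ = factAtom r t := by
  simp [factAtom, Atom.subst, Term.subst]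

section Correctness

variable [LinearOrder Val] {σ : Name → ℕ} {P₀ : Program Name Val}

theorem ways_fact [Inhabited Val] (P : Program Name Val) (r : Name) (t t' : List Val) :
    ways σ P (factAtom r t) (.mk (factAtom r t') []) =
      (({t'} : Multiset (List Val)).count t : ℕ∞) := by
  have : applications σ P (.mk (factAtom r t') []) (factAtom r t) = {l | l = [] ∧ t = t'} := by
    ext l
    simp only [applications, Rule.head, Rule.body, factAtom_subst, factAtom_inj, true_and,
      List.map_nil, wit_nil, Set.mem_ofPred_eq, Set.mem_singleton_iff, exists_const]
    rw [and_comm, eq_comm (a := t)]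
  rw [ways, this, Multiset.count_singleton]
  split_ifs with h <;> simp [h]

variable [DecidableEq Name] [Inhabited Val] {g : List ℕ → Name}

mutual

theorem Query.sum_ways_toDL (hσ : IsStratification σ P₀) (hg : Function.Injective g) :
    ∀ (Q : Query Name Val) {P : Program Name Val} {Γ : Scope Name}
      {ρ : Name → Multiset (List Val)} {H : Set Name} {p : List ℕ} {r : Name},
      Represents σ P₀ g P Γ ρ H p Q.declared → Q.WF Γ → Owns P (Q.toDL g Γ p r) (under g p) →
      r ∉ under g p → ∀ t, ((Q.toDL g Γ p r).map (ways σ P (factAtom r t))).sum =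
        ((Q.eval ρ).count t : ℕ∞)
  | .values cs => by
    intro _ _ _ _ t
    rw [Query.toDL, Query.eval, List.map_singleton, List.sum_singleton]
    exact ways_fact _ _ _ _
  | .select es S c => by
    intro h hwf hown hr t
    rename_i P Γ ρ H p r
    rw [Query.WF] at hwf
    obtain ⟨hS, hes, hc⟩ := hwf
    simp only [Query.declared] at h
    simp only [Query.toDL] at hown ⊢
    have hSz : ∀ R ∈ (S.toDL g Γ (p ++ [0])).2, R.head.pred ∈ under g (p ++ [0]) :=
      fun R hR => S.head_toDL hR
    have hcz : ∀ R ∈ (c.toDL g Γ (p ++ [1]) [varGoal (S.toDL g Γ (p ++ [0])).1 0 (S.degree Γ)]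
        (S.degree Γ)).2, R.head.pred ∈ under g (p ++ [1]) := fun R hR => c.head_toDL hR
    have hmult := S.mult_toDL hσ hg (h.child 0 (List.subset_append_left _ _)) hS
      (hown.part (_ :: (c.toDL g Γ (p ++ [1]) [varGoal (S.toDL g Γ (p ++ [0])).1 0 (S.degree Γ)]
        (S.degree Γ)).2) (by
          simp only [← Multiset.cons_coe, ← Multiset.coe_add, ← Multiset.singleton_add]; abel)
        under_child_subset (by
          intro R hR
          rcases List.mem_cons.1 hR with rfl | hR
          · exact fun h => hr (under_child_subset h)
          · exact notMem_under_of_ne hg one_ne_zero (hcz R hR)))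
    have hcond := c.holds_toDL hσ hg (h.child 1 (List.subset_append_right _ _)) hc
      (hown.part (_ :: (S.toDL g Γ (p ++ [0])).2) (by
          simp only [← Multiset.cons_coe, ← Multiset.coe_add, ← Multiset.singleton_add]; abel)
        under_child_subset (by
          intro R hR
          rcases List.mem_cons.1 hR with rfl | hR
          · exact fun h => hr (under_child_subset h)
          · exact notMem_under_of_ne hg zero_ne_one (hSz R hR))) (dependsOn_varGoal _ _)
    rw [List.map_cons, List.sum_cons, sum_map_ways_eq_zero, add_zero, Query.eval]
    · refine ways_guarded (guard := [_]) hes (S.length_of_mem_eval h.fits hS) ?_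
        (c.dependsOn_toDL hc) ?_ (fun G hG => (c.isTest_toDL G hG).mult_le_one hσ h.occurs) hcond
      · intro θ θ'
        simp [subst_varGoal_zero]
      · intro θ
        rw [List.map_singleton, encard_wit_singleton, subst_varGoal_zero]
        exact hmult _
    · rintro R hR rfl
      rcases List.mem_append.1 hR with hR | hR
      · exact hr (under_child_subset (hSz R hR))
      · exact hr (under_child_subset (hcz R hR))
  | .unionAll Q₁ Q₂ => by
    intro h hwf hown hr t
    rw [Query.WF] at hwf
    obtain ⟨h1, h2, -⟩ := hwf
    simp only [Query.declared] at h
    simp only [Query.toDL] at hown ⊢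
    rw [List.map_append, List.sum_append, Query.eval, Multiset.count_add, Nat.cast_add]
    congr 1
    · refine Q₁.sum_ways_toDL hσ hg (h.child 0 (List.subset_append_left _ _)) h1
        (hown.part _ (Multiset.coe_add _ _).symm under_child_subset fun R hR => ?_)
        (fun h => hr (under_child_subset h)) t
      rcases Q₂.head_toDL hR with h' | h'
      · exact h' ▸ fun h => hr (under_child_subset h)
      · exact notMem_under_of_ne hg one_ne_zero h'
    · refine Q₂.sum_ways_toDL hσ hg (h.child 1 (List.subset_append_right _ _)) h2
        (hown.part _ ((Multiset.coe_add _ _).symm.trans (add_comm _ _)) under_child_subset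
          fun R hR => ?_)
        (fun h => hr (under_child_subset h)) t
      rcases Q₁.head_toDL hR with h' | h'
      · exact h' ▸ fun h => hr (under_child_subset h)
      · exact notMem_under_of_ne hg zero_ne_one h'
  | .withViews vs Q => by
    intro h hwf hown hr t
    rename_i P Γ ρ H p r
    have hwf' := hwf
    rw [Query.WF] at hwf'
    obtain ⟨-, hn, -, hvs, hQ⟩ := hwf'
    simp only [Query.toDL] at hown ⊢
    set V := vs.toDL g Γ (p ++ [0]) with hV
    set R₀ : Rule Name Val := .mk ⟨r, varsFrom 0 Q.degree⟩ [.imp V (varGoal (g p) 0 Q.degree)]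
      with hR₀
    set L := Q.toDL g (vs.scope Γ) (p ++ [1]) (g p) with hL
    have hLz : ∀ R ∈ L, R.head.pred = g p ∨ R.head.pred ∈ under g (p ++ [1]) :=
      fun R hR => Q.head_toDL hR
    have hR₀P : R₀ ∈ P := by
      obtain ⟨Y, hP, -⟩ := hown
      rw [hP]
      simp
    have hVocc : ∀ R ∈ V, Occurs P₀ R := fun R hR =>
      .nested (h.occurs R₀ hR₀P) (G := .imp V (varGoal (g p) 0 Q.degree))
        (by simp [hR₀, Rule.body]) (by simp [Goal.assumed, hR])
    have hP : ∀ R ∈ P, R.head.pred ∉ under g (p ++ [0]) := by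
      obtain ⟨Y, hP, hY⟩ := hown
      intro R hR
      rw [hP] at hR
      rcases Multiset.mem_add.1 hR with hR | hR
      · rcases List.mem_cons.1 (Multiset.mem_coe.1 hR) with rfl | hR
        · exact fun h => hr (under_child_subset h)
        · rcases hLz R hR with h' | h'
          · rw [h']
            exact self_notMem_under_child hg
          · exact notMem_under_of_ne hg one_ne_zero h'
      · exact fun h => hY R hR (under_child_subset h)
    have hnames : ∀ x ∈ vs.names, ∀ q, x ≠ g q := fun x hx =>
      h.declared_ne x (by simp [Query.declared, hx])
    have hrep := h.views hg hwf hVocc hP fun h' hown' => by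
      rw [Query.WF] at hwf
      exact vs.sum_ways_toDL hσ hg h' hwf.1 hvs (fun x hx => (hn x hx).2.1) hnames hown'
    have hownL : Owns (P + (V : Program Name Val)) L (under g (p ++ [1]) ∪ {g p}) := by
      refine (hown.part [R₀] ?_ (Set.union_subset under_child_subset
        (Set.singleton_subset_iff.2 self_mem_under)) ?_).add ?_
      · rw [← Multiset.cons_coe, ← Multiset.singleton_add, add_comm, Multiset.coe_singleton]
      · intro R hR
        rw [List.mem_singleton.1 hR]
        exact fun h => hr (Set.union_subset under_child_subset
          (Set.singleton_subset_iff.2 self_mem_under) h)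
      · intro R hR
        rcases vs.head_toDL (Multiset.mem_coe.1 hR) with h' | h'
        · rintro (⟨q, -, h''⟩ | h'')
          · exact hnames _ h' q h''
          · exact hnames _ h' _ h''
        · rintro (h'' | h'')
          · exact notMem_under_of_ne hg zero_ne_one h' h''
          · rw [Set.mem_singleton_iff.1 h''] at h'
            exact self_notMem_under_child hg h'
    have ih := Q.sum_ways_toDL hσ hg hrep hQ
      (hownL.part [] (by simp [hL]) Set.subset_union_left (by simp)) (self_notMem_under_child hg)
    rw [List.map_cons, List.sum_cons, sum_map_ways_eq_zero, add_zero, Query.eval,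
      ← selection_univ (Q.eval _)]
    · refine ways_guarded_vars (k := Q.degree) (guard := [_]) (tests := [])
        (Q.length_of_mem_eval (vs.fits_eval h.fits hvs) hQ) ?_ (fun _ _ _ => rfl) ?_ (by simp)
        (by simp)
      · intro θ θ'
        simp [Goal.subst, subst_varGoal_zero]
      · intro θ
        rw [List.map_singleton, encard_wit_singleton, Goal.subst, subst_varGoal_zero, ← ih,
          ← hownL.mult_eq (A := factAtom (g p) _) (.inr rfl)]
        simp only [mult, der_imp_iff]
    · rintro R hR rfl
      rcases hLz R hR with h' | h'
      · exact hr (h' ▸ self_mem_under)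
      · exact hr (under_child_subset h')

theorem SqlRel.mult_toDL (hσ : IsStratification σ P₀) (hg : Function.Injective g) :
    ∀ (S : SqlRel Name Val) {P : Program Name Val} {Γ : Scope Name}
      {ρ : Name → Multiset (List Val)} {H : Set Name} {p : List ℕ},
      Represents σ P₀ g P Γ ρ H p S.declared → S.WF Γ → Owns P (S.toDL g Γ p).2 (under g p) →
      ∀ t, mult σ P (.atom (factAtom (S.toDL g Γ p).1 t)) = ((S.eval ρ).count t : ℕ∞)
  | .name T => by
    intro h hwf _ t
    rw [SqlRel.WF] at hwf
    rw [SqlRel.toDL, SqlRel.eval]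
    simpa using h.mult_eq 0 (by simp) (by simp) T hwf t
  | .stmt Q => by
    intro h hwf hown t
    rw [SqlRel.WF] at hwf
    simp only [SqlRel.declared] at h
    simp only [SqlRel.toDL] at hown ⊢
    rw [SqlRel.eval, hown.mult_eq (A := factAtom _ t) self_mem_under]
    exact Q.sum_ways_toDL hσ hg (h.child 0 (List.Subset.refl _)) hwf
      (hown.part [] (by simp) under_child_subset (by simp)) (self_notMem_under_child hg) t
  | .join S₁ S₂ c => by
    intro h hwf hown t
    rename_i P Γ ρ H p
    rw [SqlRel.WF] at hwf
    obtain ⟨h1, h2, hc⟩ := hwf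
    simp only [SqlRel.declared] at h
    simp only [SqlRel.toDL] at hown ⊢
    set n₁ := S₁.degree Γ with hn₁
    set n₂ := S₂.degree Γ with hn₂
    set goals := [varGoal (S₁.toDL g Γ (p ++ [0])).1 0 n₁, varGoal (S₂.toDL g Γ (p ++ [1])).1 n₁ n₂]
      with hgoals
    have hz₁ : ∀ R ∈ (S₁.toDL g Γ (p ++ [0])).2, R.head.pred ∈ under g (p ++ [0]) :=
      fun R hR => S₁.head_toDL hR
    have hz₂ : ∀ R ∈ (S₂.toDL g Γ (p ++ [1])).2, R.head.pred ∈ under g (p ++ [1]) :=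
      fun R hR => S₂.head_toDL hR
    have hzc : ∀ R ∈ (c.toDL g Γ (p ++ [2]) goals (n₁ + n₂)).2,
        R.head.pred ∈ under g (p ++ [2]) := fun R hR => c.head_toDL hR
    have hlen₁ := S₁.length_of_mem_eval h.fits h1
    have hlen₂ := S₂.length_of_mem_eval h.fits h2
    have hm₁ := S₁.mult_toDL hσ hg (h.child 0 (List.Subset.trans (List.subset_append_left _ _)
        (List.subset_append_left _ _))) h1
      (hown.part (_ :: ((S₂.toDL g Γ (p ++ [1])).2 ++
        (c.toDL g Γ (p ++ [2]) goals (n₁ + n₂)).2)) (by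
          simp only [← Multiset.cons_coe, ← Multiset.coe_add, ← Multiset.singleton_add]; abel)
        under_child_subset (by
          intro R hR
          rcases List.mem_cons.1 hR with rfl | hR
          · exact self_notMem_under_child hg
          rcases List.mem_append.1 hR with hR | hR
          · exact notMem_under_of_ne hg (by decide) (hz₂ R hR)
          · exact notMem_under_of_ne hg (by decide) (hzc R hR)))
    have hm₂ := S₂.mult_toDL hσ hg (h.child 1 (List.Subset.trans (List.subset_append_right _ _)
        (List.subset_append_left _ _))) h2
      (hown.part (_ :: ((S₁.toDL g Γ (p ++ [0])).2 ++
        (c.toDL g Γ (p ++ [2]) goals (n₁ + n₂)).2)) (by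
          simp only [← Multiset.cons_coe, ← Multiset.coe_add, ← Multiset.singleton_add]; abel)
        under_child_subset (by
          intro R hR
          rcases List.mem_cons.1 hR with rfl | hR
          · exact self_notMem_under_child hg
          rcases List.mem_append.1 hR with hR | hR
          · exact notMem_under_of_ne hg (by decide) (hz₁ R hR)
          · exact notMem_under_of_ne hg (by decide) (hzc R hR)))
    have hguard : ∀ θ θ' : ℕ → Val, goals.map (Goal.subst θ) = goals.map (Goal.subst θ') ↔
        tuple θ (n₁ + n₂) = tuple θ' (n₁ + n₂) := by
      intro θ θ'
      have happ : tuple θ (n₁ + n₂) = tuple θ' (n₁ + n₂) ↔ tuple θ n₁ = tuple θ' n₁ ∧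
          (List.range' n₁ n₂).map θ = (List.range' n₁ n₂).map θ' := by
        rw [tuple_add, tuple_add]
        exact ⟨fun h => List.append_inj h (by simp), fun h => by rw [h.1, h.2]⟩
      rw [happ]
      simp only [hgoals, List.map_cons, List.map_nil, subst_varGoal, List.cons.injEq,
        Goal.atom.injEq, factAtom_inj, true_and, and_true, tuple, List.range_eq_range']
    have hcond := c.holds_toDL hσ hg (h.child 2 (List.subset_append_right _ _)) hc
      (hown.part (_ :: ((S₁.toDL g Γ (p ++ [0])).2 ++ (S₂.toDL g Γ (p ++ [1])).2)) (by
          simp only [← Multiset.cons_coe, ← Multiset.coe_add, ← Multiset.singleton_add]; abel)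
        under_child_subset (by
          intro R hR
          rcases List.mem_cons.1 hR with rfl | hR
          · exact self_notMem_under_child hg
          rcases List.mem_append.1 hR with hR | hR
          · exact notMem_under_of_ne hg (by decide) (hz₁ R hR)
          · exact notMem_under_of_ne hg (by decide) (hz₂ R hR)))
      (fun θ θ' => (hguard θ θ').2)
    rw [hown.mult_eq (A := factAtom _ t) self_mem_under, List.map_cons, List.sum_cons,
      sum_map_ways_eq_zero, add_zero, SqlRel.eval]
    · refine ways_guarded_vars ?_ hguard (c.dependsOn_toDL hc) ?_
        (fun G hG => (c.isTest_toDL G hG).mult_le_one hσ h.occurs) hcond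
      · intro x hx
        obtain ⟨q, hq, rfl⟩ := Multiset.mem_map.1 hx
        obtain ⟨hq1, hq2⟩ := Multiset.mem_product.1 hq
        rw [List.length_append, hlen₁ _ hq1, hlen₂ _ hq2]
      · intro θ
        rw [tuple_add, count_product (by simpa using hlen₁), Nat.cast_mul, ← hm₁, ← hm₂, hgoals,
          List.map_cons, List.map_singleton, encard_wit_cons, encard_wit_singleton,
          subst_varGoal_zero, subst_varGoal]
    · intro R hR
      change _ ≠ g p
      rintro he
      simp only [List.mem_append] at hR
      rcases hR with (hR | hR) | hR
      · exact self_notMem_under_child hg (he ▸ hz₁ R hR)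
      · exact self_notMem_under_child hg (he ▸ hz₂ R hR)
      · exact self_notMem_under_child hg (he ▸ hzc R hR)

theorem Cond.holds_toDL (hσ : IsStratification σ P₀) (hg : Function.Injective g) :
    ∀ (c : Cond Name Val) {P : Program Name Val} {Γ : Scope Name}
      {ρ : Name → Multiset (List Val)} {H : Set Name} {p : List ℕ}
      {guard : List (Goal Name Val)} {k : ℕ},
      Represents σ P₀ g P Γ ρ H p c.declared → c.WF Γ k →
      Owns P (c.toDL g Γ p guard k).2 (under g p) → DependsOn k guard →
      ∀ θ, (∀ G ∈ guard, ∃ i, Der σ P i (G.subst θ)) →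
        ((∀ G ∈ (c.toDL g Γ p guard k).1, ∃ i, Der σ P i (G.subst θ)) ↔ tuple θ k ∈ c.sat ρ)
  | .tt => by
    intro _ _ _ _ θ _
    simp [Cond.toDL, Cond.sat]
  | .cmp op e₁ e₂ => by
    intro _ hwf _ _ θ _
    rw [Cond.WF] at hwf
    simp [Cond.toDL, Cond.sat, Goal.subst, Expr.subst_toTerm hwf.1, Expr.subst_toTerm hwf.2,
      der_cmp_iff]
  | .isIn es S => by
    intro h hwf hown _ θ _
    rw [Cond.WF] at hwf
    simp only [Cond.declared] at h
    simp only [Cond.toDL] at hown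
    have hm := S.mult_toDL hσ hg (h.child 0 (List.Subset.refl _)) hwf.2.1
      (hown.part [] (by simp) under_child_subset (by simp))
    simp only [Cond.toDL, Cond.sat, List.mem_singleton, forall_eq, Goal.subst,
      subst_exprAtom hwf.1, Set.mem_ofPred_eq]
    rw [exists_der_neg_neg_iff hσ h.occurs rfl, ← mult_ne_zero_iff, hm, Nat.cast_ne_zero,
      Multiset.count_ne_zero]
  | .notIn es S => by
    intro h hwf hown _ θ _
    rw [Cond.WF] at hwf
    simp only [Cond.declared] at h
    simp only [Cond.toDL] at hown
    have hm := S.mult_toDL hσ hg (h.child 0 (List.Subset.refl _)) hwf.2.1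
      (hown.part [] (by simp) under_child_subset (by simp))
    simp only [Cond.toDL, Cond.sat, List.mem_singleton, forall_eq, Goal.subst,
      subst_exprAtom hwf.1, Set.mem_ofPred_eq]
    rw [exists_der_neg_iff hσ h.occurs rfl, ← mult_ne_zero_iff, hm, Nat.cast_ne_zero,
      Multiset.count_ne_zero]
  | .exist S => by
    intro h hwf hown hdep θ hd
    clear hdep hd
    rename_i P Γ ρ H p guard k
    rw [Cond.WF] at hwf
    simp only [Cond.declared] at h
    simp only [Cond.toDL] at hown
    have hz : ∀ R ∈ (S.toDL g Γ (p ++ [0])).2, R.head.pred ∈ under g (p ++ [0]) :=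
      fun R hR => S.head_toDL hR
    have hm := S.mult_toDL hσ hg (h.child 0 (List.Subset.refl _)) hwf
      (hown.part [_] (by rw [← Multiset.cons_coe, ← Multiset.singleton_add, add_comm,
        Multiset.coe_singleton]) under_child_subset (by
          intro R hR
          rw [List.mem_singleton.1 hR]
          exact self_notMem_under_child hg))
    simp only [Cond.toDL, Cond.sat, List.mem_singleton, forall_eq, Goal.subst,
      subst_varGoal_zero, Set.mem_ofPred_eq]
    rw [exists_der_neg_neg_iff hσ h.occurs rfl, hown.exists_der_iff (A := factAtom _ _)
      self_mem_under]
    constructor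
    · rintro ⟨R, hR, θ', he, hb⟩
      rcases List.mem_cons.1 hR with rfl | hR
      · have := hb _ List.mem_cons_self
        rw [subst_varGoal_zero, ← mult_ne_zero_iff, hm, Nat.cast_ne_zero,
          Multiset.count_ne_zero] at this
        exact fun h0 => Multiset.notMem_zero _ (h0 ▸ this)
      · have h1 : R.head.pred = g p := congrArg Atom.pred he
        exact (self_notMem_under_child hg (h1 ▸ hz R hR)).elim
    · intro hne
      obtain ⟨x, hx⟩ := Multiset.exists_mem_of_ne_zero hne
      refine ⟨_, List.mem_cons_self, fun i => x.getD i default, rfl, ?_⟩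
      simp only [Rule.body, List.mem_singleton, forall_eq]
      rw [subst_varGoal_zero, tuple_getD (S.length_of_mem_eval h.fits hwf x hx),
        ← mult_ne_zero_iff, hm, Nat.cast_ne_zero, Multiset.count_ne_zero]
      exact hx
  | .and c₁ c₂ => by
    intro h hwf hown hdep θ hd
    rw [Cond.WF] at hwf
    simp only [Cond.declared] at h
    simp only [Cond.toDL] at hown
    have ih₁ := c₁.holds_toDL hσ hg (h.child 0 (List.subset_append_left _ _)) hwf.1
      (hown.part _ (Multiset.coe_add _ _).symm under_child_subset fun R hR =>
        notMem_under_of_ne hg one_ne_zero (c₂.head_toDL hR)) hdep θ hd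
    have ih₂ := c₂.holds_toDL hσ hg (h.child 1 (List.subset_append_right _ _)) hwf.2
      (hown.part _ ((Multiset.coe_add _ _).symm.trans (add_comm _ _)) under_child_subset
        fun R hR => notMem_under_of_ne hg zero_ne_one (c₁.head_toDL hR)) hdep θ hd
    simp only [Cond.toDL, Cond.sat, Set.mem_inter_iff, ← ih₁, ← ih₂, List.mem_append, or_imp,
      forall_and]
  | .or c₁ c₂ => by
    intro h hwf hown hdep θ hd
    rename_i P Γ ρ H p guard k
    rw [Cond.WF] at hwf
    simp only [Cond.declared] at h
    simp only [Cond.toDL] at hown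
    set R₁ : Rule Name Val :=
      .mk ⟨g p, varsFrom 0 k⟩ (guard ++ (c₁.toDL g Γ (p ++ [0]) guard k).1) with hR₁
    set R₂ : Rule Name Val :=
      .mk ⟨g p, varsFrom 0 k⟩ (guard ++ (c₂.toDL g Γ (p ++ [1]) guard k).1) with hR₂
    have hz₁ : ∀ R ∈ (c₁.toDL g Γ (p ++ [0]) guard k).2, R.head.pred ∈ under g (p ++ [0]) :=
      fun R hR => c₁.head_toDL hR
    have hz₂ : ∀ R ∈ (c₂.toDL g Γ (p ++ [1]) guard k).2, R.head.pred ∈ under g (p ++ [1]) :=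
      fun R hR => c₂.head_toDL hR
    have ih₁ := c₁.holds_toDL hσ hg (h.child 0 (List.subset_append_left _ _)) hwf.1
      (hown.part (R₁ :: R₂ :: (c₂.toDL g Γ (p ++ [1]) guard k).2) (by
          simp only [← Multiset.cons_coe, ← Multiset.coe_add, ← Multiset.singleton_add]; abel)
        under_child_subset (by
          intro R hR
          rcases List.mem_cons.1 hR with rfl | hR
          · exact self_notMem_under_child hg
          rcases List.mem_cons.1 hR with rfl | hR
          · exact self_notMem_under_child hg
          · exact notMem_under_of_ne hg one_ne_zero (hz₂ R hR))) hdep θ hd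
    have ih₂ := c₂.holds_toDL hσ hg (h.child 1 (List.subset_append_right _ _)) hwf.2
      (hown.part (R₁ :: R₂ :: (c₁.toDL g Γ (p ++ [0]) guard k).2) (by
          simp only [← Multiset.cons_coe, ← Multiset.coe_add, ← Multiset.singleton_add]; abel)
        under_child_subset (by
          intro R hR
          rcases List.mem_cons.1 hR with rfl | hR
          · exact self_notMem_under_child hg
          rcases List.mem_cons.1 hR with rfl | hR
          · exact self_notMem_under_child hg
          · exact notMem_under_of_ne hg zero_ne_one (hz₁ R hR))) hdep θ hd
    simp only [Cond.toDL, Cond.sat, List.mem_singleton, forall_eq, Goal.subst,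
      subst_varGoal_zero, Set.mem_union]
    rw [exists_der_neg_neg_iff hσ h.occurs rfl, hown.exists_der_iff (A := factAtom _ _)
      self_mem_under, ← ih₁, ← ih₂]
    rw [← exists_subst_body_iff (q := g p) (c₁.dependsOn_toDL hwf.1) hd,
      ← exists_subst_body_iff (q := g p) (c₂.dependsOn_toDL hwf.2) hd]
    constructor
    · rintro ⟨R, hR, θ', he, hb⟩
      rcases List.mem_cons.1 hR with rfl | hR
      · exact .inl ⟨θ', he, hb⟩
      rcases List.mem_cons.1 hR with rfl | hR
      · exact .inr ⟨θ', he, hb⟩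
      have h1 : R.head.pred = g p := congrArg Atom.pred he
      rcases List.mem_append.1 hR with hR | hR
      · exact (self_notMem_under_child hg (h1 ▸ hz₁ R hR)).elim
      · exact (self_notMem_under_child hg (h1 ▸ hz₂ R hR)).elim
    · rintro (h' | h')
      · exact ⟨_, List.mem_cons_self, h'⟩
      · exact ⟨_, List.mem_cons_of_mem _ List.mem_cons_self, h'⟩
  | .not c => by
    intro h hwf hown hdep θ hd
    rename_i P Γ ρ H p guard k
    rw [Cond.WF] at hwf
    simp only [Cond.declared] at h
    simp only [Cond.toDL] at hown
    have hz : ∀ R ∈ (c.toDL g Γ (p ++ [0]) guard k).2, R.head.pred ∈ under g (p ++ [0]) :=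
      fun R hR => c.head_toDL hR
    have ih := c.holds_toDL hσ hg (h.child 0 (List.Subset.refl _)) hwf
      (hown.part [_] (by rw [← Multiset.cons_coe, ← Multiset.singleton_add, add_comm,
        Multiset.coe_singleton]) under_child_subset (by
          intro R hR
          rw [List.mem_singleton.1 hR]
          exact self_notMem_under_child hg)) hdep θ hd
    simp only [Cond.toDL, Cond.sat, List.mem_singleton, forall_eq, Goal.subst,
      subst_varGoal_zero, Set.mem_compl_iff]
    rw [exists_der_neg_iff hσ h.occurs rfl, hown.exists_der_iff (A := factAtom _ _)
      self_mem_under, ← ih, ← exists_subst_body_iff (q := g p) (c.dependsOn_toDL hwf) hd,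
      not_iff_not]
    constructor
    · rintro ⟨R, hR, θ', he, hb⟩
      rcases List.mem_cons.1 hR with rfl | hR
      · exact ⟨θ', he, hb⟩
      have h1 : R.head.pred = g p := congrArg Atom.pred he
      exact (self_notMem_under_child hg (h1 ▸ hz R hR)).elim
    · exact fun h' => ⟨_, List.mem_cons_self, h'⟩

theorem Views.sum_ways_toDL (hσ : IsStratification σ P₀) (hg : Function.Injective g) :
    ∀ (vs : Views Name Val) {P : Program Name Val} {Γ : Scope Name}
      {ρ : Name → Multiset (List Val)} {H : Set Name} {p : List ℕ},
      Represents σ P₀ g P Γ ρ H p vs.declared → vs.names.Nodup → vs.WF Γ →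
      (∀ x ∈ vs.names, x ∉ vs.declared) → (∀ x ∈ vs.names, ∀ q, x ≠ g q) →
      Owns P (vs.toDL g Γ p) (under g p) →
      ∀ x ∈ vs.names, ∀ t, ((vs.toDL g Γ p).map (ways σ P (factAtom x t))).sum =
        ((vs.eval ρ x).count t : ℕ∞)
  | .nil => by
    intro _ _ _ _ _ _ x hx
    simp [Views.names] at hx
  | .cons r Q vs => by
    intro h hnd hwf hdisj hne hown x hx t
    rename_i P Γ ρ H p
    rw [Views.WF] at hwf
    simp only [Views.declared] at h hdisj
    simp only [Views.names, List.nodup_cons] at hnd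
    simp only [Views.names, List.mem_cons, forall_eq_or_imp] at hne hdisj hx
    simp only [Views.toDL] at hown ⊢
    have hnu : ∀ y, (y = r ∨ y ∈ vs.names) → ∀ q, y ∉ under g q := by
      rintro y hy q ⟨q', -, hq'⟩
      rcases hy with rfl | hy
      · exact hne.1 q' hq'
      · exact hne.2 y hy q' hq'
    rw [List.map_append, List.sum_append, Views.eval]
    split_ifs with hxr
    · subst hxr
      rw [sum_map_ways_eq_zero (L := vs.toDL g Γ (p ++ [1])), add_zero]
      · refine Q.sum_ways_toDL hσ hg (h.child 0 (List.subset_append_left _ _)) hwf.1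
          (hown.part _ (Multiset.coe_add _ _).symm under_child_subset fun R hR => ?_)
          (hnu _ (.inl rfl) _) t
        rcases vs.head_toDL hR with h' | h'
        · exact hnu _ (.inr h') _
        · exact notMem_under_of_ne hg one_ne_zero h'
      · rintro R hR he
        rcases vs.head_toDL hR with h' | h'
        · rw [he] at h'
          exact hnd.1 h'
        · exact hnu _ (.inl he) _ h'
    · have hxv : x ∈ vs.names := hx.resolve_left hxr
      rw [sum_map_ways_eq_zero (L := Q.toDL g Γ (p ++ [0]) r), zero_add]
      · refine vs.sum_ways_toDL hσ hg (h.child 1 (List.subset_append_right _ _)) hnd.2 hwf.2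
          (fun y hy hyd => hdisj.2 y hy (List.mem_append_right _ hyd)) hne.2
          (hown.part _ ((Multiset.coe_add _ _).symm.trans (add_comm _ _)) under_child_subset
            fun R hR => ?_) x hxv t
        rcases Q.head_toDL hR with h' | h'
        · exact hnu _ (.inl h') _
        · exact notMem_under_of_ne hg zero_ne_one h'
      · rintro R hR he
        rcases Q.head_toDL hR with h' | h'
        · exact hxr (he.symm.trans h')
        · rw [he] at h'
          exact hnu x (.inr hxv) _ h'

end

end Correctness

theorem Database.mem_facts {Δ : Database Name Val} {R : Rule Name Val} (h : R ∈ Δ.facts) :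
    ∃ T ∈ Δ.tables, ∃ t ∈ Δ.inst T, R = .mk (factAtom T t) [] := by
  obtain ⟨T, hT, h⟩ := Multiset.mem_sum.1 h
  obtain ⟨t, ht, rfl⟩ := Multiset.mem_map.1 h
  exact ⟨T, hT, t, ht, rfl⟩

theorem Database.fits [DecidableEq Name] (Δ : Database Name Val) :
    Fits Δ.scope (fun T => if T ∈ Δ.tables then Δ.inst T else 0) := by
  intro T d hd t ht
  simp only [Database.scope] at hd
  split_ifs at hd with h
  simp only [h, if_true] at ht
  rw [Δ.length_eq T h t ht]
  exact Option.some.inj hd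

theorem Database.sum_ways_facts [Inhabited Val] [LinearOrder Val] {σ : Name → ℕ}
    (Δ : Database Name Val) (P : Program Name Val) {T : Name} (hT : T ∈ Δ.tables) (t : List Val) :
    (Δ.facts.map (ways σ P (factAtom T t))).sum = ((Δ.inst T).count t : ℕ∞) := by
  have hsum : ∀ m : Multiset (List Val),
      (m.map (fun t' => ways σ P (factAtom T t) (.mk (factAtom T t') []))).sum =
        (m.count t : ℕ∞) := by
    intro m
    induction m using Multiset.induction_on with
    | empty => simp
    | cons a m ih =>
      rw [Multiset.map_cons, Multiset.sum_cons, ih, ways_fact, ← Nat.cast_add,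
        ← Multiset.count_add, Multiset.singleton_add]
  rw [Database.facts, ← Multiset.mapAddMonoidHom_apply, map_sum, Multiset.sum_sum,
    Finset.sum_eq_single_of_mem T hT]
  · rw [Multiset.mapAddMonoidHom_apply, Multiset.map_map, ← hsum]
    rfl
  · intro T' _ hne
    rw [Multiset.mapAddMonoidHom_apply]
    refine sum_ways_eq_zero fun R hR => ?_
    obtain ⟨t', -, rfl⟩ := Multiset.mem_map.1 hR
    exact hne

theorem meaningIn_solve_eq [LinearOrder Val] {σ : Name → ℕ}
    {P : Program Name Val} {φ ψ : Goal Name Val}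
    (h : ∃ θ : ℕ → Val, φ.subst θ = ψ) :
    meaningIn P (solve φ (unifiedSemantics P σ)) ψ = mult σ P ψ := by
  rw [meaningIn, mult]
  congr 1
  ext i
  simp only [solve, unifiedSemantics, Der, Set.mem_ofPred_eq, h, and_true, le_refl, true_and]
  exact ⟨fun h => h.2, fun h => ⟨fun R hR => .base hR, h⟩⟩

theorem meaningIn_solve_eq_zero [LinearOrder Val] {σ : Name → ℕ}
    {P : Program Name Val} {φ ψ : Goal Name Val}
    (h : ¬ ∃ θ : ℕ → Val, φ.subst θ = ψ) :
    meaningIn P (solve φ (unifiedSemantics P σ)) ψ = 0 := by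
  rw [meaningIn, Set.encard_eq_zero, Set.eq_empty_iff_forall_notMem]
  exact fun i hi => h hi.2

section Answer

variable [DecidableEq Name] [Inhabited Val] [LinearOrder Val] {σ : Name → ℕ}

theorem mult_eq_count_computedAnswer {Δ : Database Name Val} {r : Name} {Q : Query Name Val}
    {g : List ℕ → Name} (hQ : Q.WF Δ.scope) (hr : r ∉ Δ.tables) (hrQ : r ∉ Q.declared)
    (hg : IsFreshSupply g Δ r Q) (hσ : IsStratification σ (Δ.facts + sqlToDL g Δ r Q))
    (t : List Val) :
    mult σ (Δ.facts + sqlToDL g Δ r Q) (.atom (factAtom r t)) =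
      ((computedAnswer Δ Q).count t : ℕ∞) := by
  obtain ⟨hinj, hfresh⟩ := hg
  have hhead : ∀ R ∈ sqlToDL g Δ r Q, R.head.pred = r ∨ R.head.pred ∈ under g [] :=
    fun R hR => Q.head_toDL (Multiset.mem_coe.1 hR)
  have hru : r ∉ under g [] := by
    rintro ⟨q, -, rfl⟩
    exact (hfresh q).2.1 rfl
  have hown : Owns (Δ.facts + sqlToDL g Δ r Q) (Q.toDL g Δ.scope [] r) (under g [] ∪ {r}) := by
    refine ⟨Δ.facts, add_comm _ _, fun R hR => ?_⟩
    obtain ⟨T, hT, t', -, rfl⟩ := Database.mem_facts hR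
    rintro (⟨q, -, h⟩ | h)
    · exact (hfresh q).1 (h ▸ hT)
    · exact hr (Set.mem_singleton_iff.1 h ▸ hT)
  have hdecl : ∀ x ∈ Q.declared, x ∉ Δ.tables := by
    intro x hx hT
    have := Q.scope_declared hQ hx
    simp [Database.scope, hT] at this
  have hhead' : ∀ R ∈ sqlToDL g Δ r Q, R.head.pred ∉ Δ.tables := by
    intro R hR hT
    rcases hhead R hR with h | ⟨q, -, h⟩
    · exact hr (h ▸ hT)
    · exact (hfresh q).1 (h ▸ hT)
  have hrep : Represents σ (Δ.facts + sqlToDL g Δ r Q) g (Δ.facts + sqlToDL g Δ r Q) Δ.scope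
      (fun T => if T ∈ Δ.tables then Δ.inst T else 0) {T | T ∈ Δ.tables} [] Q.declared := by
    refine ⟨fun R hR => .base hR, ?_, Δ.fits, ?_, hdecl, ?_, ?_⟩
    · intro X _ hXH T hT t
      have hT' : T ∈ Δ.tables := by
        by_contra h
        simp [Database.scope, h] at hT
      rw [mult_atom, add_assoc, Multiset.map_add, Multiset.sum_add, Δ.sum_ways_facts _ hT',
        sum_ways_eq_zero, add_zero, if_pos hT']
      rintro R hR he
      rcases Multiset.mem_add.1 hR with hR | hR
      · exact hhead' R hR (he ▸ hT')
      · exact hXH R hR (he ▸ hT')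
    · rintro _ ⟨q, -, rfl⟩
      exact (hfresh q).1
    · rintro x hx q rfl
      exact (hfresh q).2.2 hx
    · rintro x hx R hR rfl
      rcases Multiset.mem_add.1 hR with hR | hR
      · obtain ⟨T, hT, t', -, rfl⟩ := Database.mem_facts hR
        exact hdecl _ hx hT
      · rcases hhead R hR with h | ⟨q, -, h⟩
        · exact hrQ (h ▸ hx)
        · exact (hfresh q).2.2 (h ▸ hx)
  rw [hown.mult_eq (A := factAtom r t) (.inr rfl), computedAnswer]
  exact Q.sum_ways_toDL hσ hinj hrep hQ
    (hown.part [] (by simp) Set.subset_union_left (by simp)) hru t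

open Classical in
theorem meaningIn_solve_eq_countFun {Δ : Database Name Val} {r : Name} {Q : Query Name Val}
    {g : List ℕ → Name} (hQ : Q.WF Δ.scope) (hr : r ∉ Δ.tables) (hrQ : r ∉ Q.declared)
    (hg : IsFreshSupply g Δ r Q) (hσ : IsStratification σ (Δ.facts + sqlToDL g Δ r Q)) :
    meaningIn (Δ.facts + sqlToDL g Δ r Q)
        (solve (varGoal r 0 Q.degree) (unifiedSemantics (Δ.facts + sqlToDL g Δ r Q) σ)) =
      countFun ((computedAnswer Δ Q).map fun t => .atom (factAtom r t)) := by
  have hinj : Function.Injective fun t : List Val => (Goal.atom (factAtom r t) : Goal Name Val) := by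
    intro t t' h
    simpa using h
  funext ψ
  rw [countFun]
  by_cases hψ : ∃ θ : ℕ → Val, (varGoal r 0 Q.degree : Goal Name Val).subst θ = ψ
  · rw [meaningIn_solve_eq hψ]
    obtain ⟨θ, rfl⟩ := hψ
    rw [subst_varGoal_zero, mult_eq_count_computedAnswer hQ hr hrQ hg hσ]
    have := Multiset.count_map_eq_count' _ (computedAnswer Δ Q) hinj (tuple θ Q.degree)
    rw [this]
  · rw [meaningIn_solve_eq_zero hψ, eq_comm, Nat.cast_eq_zero, Multiset.count_eq_zero]
    intro hmem
    obtain ⟨t, ht, rfl⟩ := Multiset.mem_map.1 hmem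
    refine hψ ⟨fun i => t.getD i default, ?_⟩
    rw [subst_varGoal_zero, tuple_getD (Q.length_of_mem_eval Δ.fits hQ t ht)]

end Answer

/-! ## Existence of a stratification -/

section Stratification

variable {σ : Name → ℕ}

theorem Occurs.of_add {P P' : Program Name Val} {R : Rule Name Val} (h : Occurs (P + P') R) :
    Occurs P R ∨ Occurs P' R := by
  induction h with
  | base h => exact (Multiset.mem_add.1 h).imp .base .base
  | nested _ hG hR ih => exact ih.imp (.nested · hG hR) (.nested · hG hR)

theorem Occurs.of_singleton {R R' : Rule Name Val} (h : Occurs {R} R') :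
    R' = R ∨ ∃ G ∈ R.body, Occurs (G.assumed : Program Name Val) R' := by
  induction h with
  | base h => exact .inl (Multiset.mem_singleton.1 h)
  | nested _ hG hR ih =>
    rcases ih with rfl | ⟨G', hG', h⟩
    · exact .inr ⟨_, hG, .base (Multiset.mem_coe.2 hR)⟩
    · exact .inr ⟨G', hG', .nested h hG hR⟩

theorem isStratification_zero : IsStratification σ (0 : Program Name Val) := by
  intro R h
  exfalso
  induction h with
  | base h => exact Multiset.notMem_zero _ h
  | nested _ _ _ ih => exact ih

theorem IsStratification.add {P P' : Program Name Val} (h : IsStratification σ P)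
    (h' : IsStratification σ P') : IsStratification σ (P + P') :=
  fun R hR => hR.of_add.elim (h R) (h' R)

theorem IsStratification.append {L L' : List (Rule Name Val)}
    (h : IsStratification σ (L : Program Name Val))
    (h' : IsStratification σ (L' : Program Name Val)) :
    IsStratification σ ((L ++ L' : List (Rule Name Val)) : Program Name Val) := by
  rw [← Multiset.coe_add]
  exact h.add h'

theorem IsStratification.cons {R : Rule Name Val} {L : List (Rule Name Val)}
    (h : IsStratification σ (L : Program Name Val))
    (hR : ∀ G ∈ R.body, G.level σ ≤ σ R.head.pred ∧
      IsStratification σ (G.assumed : Program Name Val)) :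
    IsStratification σ ((R :: L : List (Rule Name Val)) : Program Name Val) := by
  rw [← Multiset.cons_coe, ← Multiset.singleton_add]
  refine .add (fun R' hR' => ?_) h
  rcases hR'.of_singleton with rfl | ⟨G, hG, hR'⟩
  · exact fun G hG => (hR G hG).1
  · exact (hR G hG).2 R' hR'

/-- A rule whose goals assume nothing. -/
theorem IsStratification.cons_plain {R : Rule Name Val} {L : List (Rule Name Val)}
    (h : IsStratification σ (L : Program Name Val))
    (hR : ∀ G ∈ R.body, G.assumed = [] ∧ G.level σ ≤ σ R.head.pred) :
    IsStratification σ ((R :: L : List (Rule Name Val)) : Program Name Val) :=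
  h.cons fun G hG => ⟨(hR G hG).2, by
    rw [(hR G hG).1]
    exact isStratification_zero⟩

theorem Database.isStratification_facts (Δ : Database Name Val) : IsStratification σ Δ.facts := by
  have h : ∀ R, Occurs Δ.facts R → R.body = [] := by
    intro R hR
    induction hR with
    | base h =>
      obtain ⟨T, -, t, -, rfl⟩ := Database.mem_facts h
      rfl
    | nested _ hG _ ih => simp [ih] at hG
  intro R hR G hG
  simp [h R hR] at hG

/-- The names that the translation of a part of a statement introduces: those supplied at the
position `p` or below, and the declared names `D`. -/
def introduced (g : List ℕ → Name) (p : List ℕ) (D : List Name) : Set Name :=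
  under g p ∪ {x | x ∈ D}

variable {g : List ℕ → Name} {p : List ℕ} {D D' : List Name} {i j : ℕ}

theorem introduced_child_subset (h : D' ⊆ D) : introduced g (p ++ [i]) D' ⊆ introduced g p D :=
  Set.union_subset_union under_child_subset fun _ hx => h hx

theorem singleton_self_subset_introduced : {g p} ⊆ introduced g p D :=
  Set.singleton_subset_iff.2 (.inl self_mem_under)

theorem disjoint_introduced (hg : Function.Injective g) (hij : i ≠ j) (hD : List.Disjoint D D')
    (h : ∀ x ∈ D, ∀ q, x ≠ g q) (h' : ∀ x ∈ D', ∀ q, x ≠ g q) :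
    Disjoint (introduced g (p ++ [i]) D) (introduced g (p ++ [j]) D') := by
  rw [Set.disjoint_left]
  rintro x (hx | hx) (hx' | hx')
  · exact notMem_under_of_ne hg hij hx hx'
  · obtain ⟨q, -, hq⟩ := hx
    exact h' x hx' q hq
  · obtain ⟨q, -, hq⟩ := hx'
    exact h x hx q hq
  · exact hD hx hx'

theorem disjoint_introduced_self (hg : Function.Injective g) (h : ∀ x ∈ D, ∀ q, x ≠ g q) :
    Disjoint (introduced g (p ++ [i]) D) {g p} := by
  rw [Set.disjoint_singleton_right]
  rintro (hx | hx)
  · exact self_notMem_under_child hg hx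
  · exact h _ hx p rfl

theorem exists_glue (τ₁ τ₂ : Name → ℕ) {S₁ S₂ : Set Name} (h : Disjoint S₁ S₂) :
    ∃ τ : Name → ℕ, ∀ (σ : Name → ℕ) (S : Set Name), Set.EqOn σ τ S → S₁ ⊆ S → S₂ ⊆ S →
      Set.EqOn σ τ₁ S₁ ∧ Set.EqOn σ τ₂ S₂ := by
  classical
  refine ⟨S₁.piecewise τ₁ τ₂, fun σ S hσ h₁ h₂ => ⟨fun x hx => ?_, fun x hx => ?_⟩⟩
  · rw [hσ (h₁ hx), Set.piecewise_eq_of_mem _ _ _ hx]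
  · rw [hσ (h₂ hx), Set.piecewise_eq_of_notMem _ _ _ (Set.disjoint_right.1 h hx)]

variable [DecidableEq Name]

mutual

theorem Query.exists_levels (hg : Function.Injective g) :
    ∀ (Q : Query Name Val) (Γ : Scope Name) (p : List ℕ) (b : ℕ), Q.WF Γ → Q.declared.Nodup →
      (∀ x ∈ Q.declared, ∀ q, x ≠ g q) →
      ∃ N ≥ b, ∃ τ : Name → ℕ, ∀ σ : Name → ℕ, Set.EqOn σ τ (introduced g p Q.declared) →
        (∀ T, (Γ T).isSome → σ T ≤ b) → ∀ r, N ≤ σ r →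
          IsStratification σ (Q.toDL g Γ p r : Program Name Val)
  | .values cs, Γ, p, b => by
    intro _ _ _
    refine ⟨b, le_rfl, 0, fun σ _ _ r _ => ?_⟩
    rw [Query.toDL]
    exact isStratification_zero.cons_plain (L := []) (by simp [Rule.body])
  | .select es S c, Γ, p, b => by
    intro hwf hnd hne
    rw [Query.WF] at hwf
    simp only [Query.declared, List.nodup_append', List.mem_append, or_imp, forall_and]
      at hnd hne
    obtain ⟨N₁, hN₁, τ₁, h₁⟩ := S.exists_levels hg Γ (p ++ [0]) b hwf.1 hnd.1 hne.1
    obtain ⟨N₂, hN₂, τ₂, h₂⟩ := c.exists_levels hg Γ (p ++ [1]) N₁ _ hwf.2.2 hnd.2.1 hne.2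
    obtain ⟨τ, hτ⟩ := exists_glue τ₁ τ₂
      (disjoint_introduced (p := p) hg zero_ne_one hnd.2.2 hne.1 hne.2)
    refine ⟨N₂, hN₁.le.trans hN₂, τ, fun σ hσ hb r hr => ?_⟩
    rw [Query.declared] at hσ
    obtain ⟨e₁, e₂⟩ := hτ σ _ hσ (introduced_child_subset (List.subset_append_left _ _))
      (introduced_child_subset (List.subset_append_right _ _))
    obtain ⟨hl₁, hs₁⟩ := h₁ σ e₁ hb
    obtain ⟨hl₂, hs₂⟩ := h₂ σ e₂ (fun T hT => (hb T hT).trans hN₁)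
      [varGoal (S.toDL g Γ (p ++ [0])).1 0 (S.degree Γ)]
      (by simpa [varGoal, Goal.assumed, Goal.level] using hl₁)
    simp only [Query.toDL]
    refine (hs₁.append hs₂).cons_plain fun G hG => ?_
    rcases List.mem_cons.1 hG with rfl | hG
    · exact ⟨rfl, hl₁.trans (hN₂.le.trans hr)⟩
    · exact ⟨(c.isTest_toDL G hG).assumed_eq, (hl₂ G hG).trans hr⟩
  | .unionAll Q₁ Q₂, Γ, p, b => by
    intro hwf hnd hne
    rw [Query.WF] at hwf
    simp only [Query.declared, List.nodup_append', List.mem_append, or_imp, forall_and]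
      at hnd hne
    obtain ⟨N₁, hN₁, τ₁, h₁⟩ := Q₁.exists_levels hg Γ (p ++ [0]) b hwf.1 hnd.1 hne.1
    obtain ⟨N₂, hN₂, τ₂, h₂⟩ := Q₂.exists_levels hg Γ (p ++ [1]) b hwf.2.1 hnd.2.1 hne.2
    obtain ⟨τ, hτ⟩ := exists_glue τ₁ τ₂
      (disjoint_introduced (p := p) hg zero_ne_one hnd.2.2 hne.1 hne.2)
    refine ⟨max N₁ N₂, le_max_of_le_left hN₁, τ, fun σ hσ hb r hr => ?_⟩
    rw [Query.declared] at hσ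
    obtain ⟨e₁, e₂⟩ := hτ σ _ hσ (introduced_child_subset (List.subset_append_left _ _))
      (introduced_child_subset (List.subset_append_right _ _))
    rw [Query.toDL]
    exact (h₁ σ e₁ hb r ((le_max_left _ _).trans hr)).append
      (h₂ σ e₂ hb r ((le_max_right _ _).trans hr))
  | .withViews vs Q, Γ, p, b => by
    intro hwf hnd hne
    rw [Query.WF] at hwf
    obtain ⟨-, -, -, hvs, hQ⟩ := hwf
    rw [Query.declared] at hne hnd
    have hne' : ∀ x ∈ Q.declared, ∀ q, x ≠ g q :=
      fun x hx => hne x (List.mem_append_right _ hx)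
    have hne'' : ∀ x ∈ vs.names ++ vs.declared, ∀ q, x ≠ g q :=
      fun x hx => hne x (List.mem_append_left _ hx)
    obtain ⟨hnd₁, hnd₂, hdis⟩ := List.nodup_append'.1 hnd
    obtain ⟨N₁, hN₁, τ₁, h₁⟩ := vs.exists_levels hg Γ (p ++ [0]) b hvs hnd₁ hne''
    obtain ⟨N₂, hN₂, τ₂, h₂⟩ := Q.exists_levels hg (vs.scope Γ) (p ++ [1]) N₁ hQ hnd₂ hne'
    obtain ⟨τ₃, hτ₃⟩ := exists_glue τ₁ τ₂
      (disjoint_introduced (p := p) hg zero_ne_one hdis hne'' hne')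
    obtain ⟨τ, hτ⟩ := exists_glue τ₃ (fun _ => N₂) (Set.disjoint_union_left.2
      ⟨disjoint_introduced_self (p := p) (i := 0) hg hne'',
        disjoint_introduced_self (p := p) (i := 1) hg hne'⟩)
    refine ⟨N₂, hN₁.le.trans hN₂, τ, fun σ hσ hb r hr => ?_⟩
    rw [Query.declared] at hσ
    obtain ⟨e, e₃⟩ := hτ σ _ hσ (Set.union_subset
      (introduced_child_subset (List.subset_append_left _ _))
      (introduced_child_subset (List.subset_append_right _ _))) singleton_self_subset_introduced
    obtain ⟨e₁, e₂⟩ := hτ₃ σ _ e Set.subset_union_left Set.subset_union_right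
    have hgp : σ (g p) = N₂ := e₃ rfl
    obtain ⟨hl, hs⟩ := h₁ σ e₁ hb
    have hsQ := h₂ σ e₂ (fun T hT => by
      by_cases hTn : T ∈ vs.names
      · exact hl T hTn
      · rw [Views.scope_of_notMem hTn] at hT
        exact (hb T hT).trans hN₁) (g p) hgp.ge
    simp only [Query.toDL]
    refine hsQ.cons fun G hG => ?_
    simp only [Rule.body, List.mem_singleton] at hG
    subst hG
    refine ⟨?_, ?_⟩
    · change σ (g p) ≤ σ r
      rwa [hgp]
    · simpa [Goal.assumed, varGoal] using hs

theorem SqlRel.exists_levels (hg : Function.Injective g) :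
    ∀ (S : SqlRel Name Val) (Γ : Scope Name) (p : List ℕ) (b : ℕ), S.WF Γ → S.declared.Nodup →
      (∀ x ∈ S.declared, ∀ q, x ≠ g q) →
      ∃ N ≥ b, ∃ τ : Name → ℕ, ∀ σ : Name → ℕ, Set.EqOn σ τ (introduced g p S.declared) →
        (∀ T, (Γ T).isSome → σ T ≤ b) → σ (S.toDL g Γ p).1 ≤ N ∧
          IsStratification σ ((S.toDL g Γ p).2 : Program Name Val)
  | .name T, Γ, p, b => by
    intro hwf _ _
    rw [SqlRel.WF] at hwf
    refine ⟨b, le_rfl, 0, fun σ _ hb => ?_⟩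
    rw [SqlRel.toDL]
    exact ⟨hb T hwf, isStratification_zero⟩
  | .stmt Q, Γ, p, b => by
    intro hwf hnd hne
    rw [SqlRel.WF] at hwf
    simp only [SqlRel.declared] at hnd hne
    obtain ⟨N, hN, τ₁, h⟩ := Q.exists_levels hg Γ (p ++ [0]) b hwf hnd hne
    obtain ⟨τ, hτ⟩ := exists_glue τ₁ (fun _ => N)
      (disjoint_introduced_self (p := p) (i := 0) hg hne)
    refine ⟨N, hN, τ, fun σ hσ hb => ?_⟩
    rw [SqlRel.declared] at hσ
    obtain ⟨e₁, e₂⟩ := hτ σ _ hσ (introduced_child_subset (List.Subset.refl _))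
      singleton_self_subset_introduced
    have hgp : σ (g p) = N := e₂ rfl
    simp only [SqlRel.toDL]
    exact ⟨hgp.le, h σ e₁ hb _ hgp.ge⟩
  | .join S₁ S₂ c, Γ, p, b => by
    intro hwf hnd hne
    rw [SqlRel.WF] at hwf
    rw [SqlRel.declared] at hnd hne
    have hne₃ : ∀ x ∈ c.declared, ∀ q, x ≠ g q := fun x hx => hne x (by simp [hx])
    have hne₂ : ∀ x ∈ S₂.declared, ∀ q, x ≠ g q := fun x hx => hne x (by simp [hx])
    have hne₁ : ∀ x ∈ S₁.declared, ∀ q, x ≠ g q := fun x hx => hne x (by simp [hx])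
    obtain ⟨hnd₁₂, hnd₃, hdis⟩ := List.nodup_append'.1 hnd
    obtain ⟨hnd₁, hnd₂, hdis₁₂⟩ := List.nodup_append'.1 hnd₁₂
    obtain ⟨hdis₁, hdis₂⟩ := List.disjoint_append_left.1 hdis
    obtain ⟨N₁, hN₁, τ₁, h₁⟩ := S₁.exists_levels hg Γ (p ++ [0]) b hwf.1 hnd₁ hne₁
    obtain ⟨N₂, hN₂, τ₂, h₂⟩ := S₂.exists_levels hg Γ (p ++ [1]) N₁ hwf.2.1 hnd₂ hne₂
    obtain ⟨N₃, hN₃, τ₃, h₃⟩ := c.exists_levels hg Γ (p ++ [2]) N₂ _ hwf.2.2 hnd₃ hne₃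
    obtain ⟨τ₄, hτ₄⟩ := exists_glue τ₁ τ₂
      (disjoint_introduced (p := p) hg zero_ne_one hdis₁₂ hne₁ hne₂)
    obtain ⟨τ₅, hτ₅⟩ := exists_glue τ₄ τ₃ (Set.disjoint_union_left.2
      ⟨disjoint_introduced (p := p) (i := 0) (j := 2) hg (by decide) hdis₁ hne₁ hne₃,
        disjoint_introduced (p := p) (i := 1) hg (by decide) hdis₂ hne₂ hne₃⟩)
    obtain ⟨τ, hτ⟩ := exists_glue τ₅ (fun _ => N₃) (Set.disjoint_union_left.2
      ⟨Set.disjoint_union_left.2 ⟨disjoint_introduced_self (p := p) (i := 0) hg hne₁,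
        disjoint_introduced_self (p := p) (i := 1) hg hne₂⟩,
        disjoint_introduced_self (p := p) (i := 2) hg hne₃⟩)
    refine ⟨N₃, hN₁.le.trans (hN₂.le.trans hN₃), τ, fun σ hσ hb => ?_⟩
    rw [SqlRel.declared] at hσ
    obtain ⟨e, e₄⟩ := hτ σ _ hσ (Set.union_subset (Set.union_subset
      (introduced_child_subset fun x hx => by simp [hx])
      (introduced_child_subset fun x hx => by simp [hx]))
      (introduced_child_subset fun x hx => by simp [hx])) singleton_self_subset_introduced
    obtain ⟨e', e₃⟩ := hτ₅ σ _ e Set.subset_union_left Set.subset_union_right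
    obtain ⟨e₁, e₂⟩ := hτ₄ σ _ e' Set.subset_union_left Set.subset_union_right
    have hgp : σ (g p) = N₃ := e₄ rfl
    obtain ⟨hl₁, hs₁⟩ := h₁ σ e₁ hb
    have hb' : ∀ T, (Γ T).isSome → σ T ≤ N₁ := fun T hT => (hb T hT).trans hN₁
    obtain ⟨hl₂, hs₂⟩ := h₂ σ e₂ hb'
    have hgoals : ∀ G ∈ [(varGoal (S₁.toDL g Γ (p ++ [0])).1 0 (S₁.degree Γ) : Goal Name Val),
        varGoal (S₂.toDL g Γ (p ++ [1])).1 (S₁.degree Γ) (S₂.degree Γ)],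
        G.assumed = [] ∧ G.level σ ≤ N₂ := by
      intro G hG
      simp only [List.mem_cons, List.not_mem_nil, or_false] at hG
      rcases hG with rfl | rfl
      · exact ⟨rfl, hl₁.trans hN₂⟩
      · exact ⟨rfl, hl₂⟩
    obtain ⟨hl₃, hs₃⟩ := h₃ σ e₃ (fun T hT => (hb' T hT).trans hN₂) _ hgoals
    simp only [SqlRel.toDL]
    refine ⟨hgp.le, ((hs₁.append hs₂).append hs₃).cons_plain fun G hG => ?_⟩
    change _ ∧ _ ≤ σ (g p)
    rw [hgp]
    rcases List.mem_append.1 hG with hG | hG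
    · exact ⟨(hgoals G hG).1, (hgoals G hG).2.trans hN₃⟩
    · exact ⟨(c.isTest_toDL G hG).assumed_eq, hl₃ G hG⟩

theorem Cond.exists_levels (hg : Function.Injective g) :
    ∀ (c : Cond Name Val) (Γ : Scope Name) (p : List ℕ) (b k : ℕ), c.WF Γ k →
      c.declared.Nodup → (∀ x ∈ c.declared, ∀ q, x ≠ g q) →
      ∃ N ≥ b, ∃ τ : Name → ℕ, ∀ σ : Name → ℕ, Set.EqOn σ τ (introduced g p c.declared) →
        (∀ T, (Γ T).isSome → σ T ≤ b) → ∀ guard : List (Goal Name Val),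
          (∀ G ∈ guard, G.assumed = [] ∧ G.level σ ≤ b) →
          (∀ G ∈ (c.toDL g Γ p guard k).1, G.level σ ≤ N) ∧
          IsStratification σ ((c.toDL g Γ p guard k).2 : Program Name Val)
  | .tt, Γ, p, b, k => by
    intro _ _ _
    refine ⟨b, le_rfl, 0, fun σ _ hb guard _ => ?_⟩
    rw [Cond.toDL]
    exact ⟨by simp, isStratification_zero⟩
  | .cmp op e₁ e₂, Γ, p, b, k => by
    intro _ _ _
    refine ⟨b, le_rfl, 0, fun σ _ hb guard _ => ?_⟩
    rw [Cond.toDL]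
    exact ⟨by simp [Goal.level], isStratification_zero⟩
  | .isIn es S, Γ, p, b, k => by
    intro hwf hnd hne
    rw [Cond.WF] at hwf
    simp only [Cond.declared] at hnd hne
    obtain ⟨N, hN, τ, h⟩ := S.exists_levels hg Γ (p ++ [0]) b hwf.2.1 hnd hne
    refine ⟨N + 2, Nat.le_add_right_of_le hN, τ, fun σ hσ hb guard _ => ?_⟩
    rw [Cond.declared] at hσ
    obtain ⟨hl, hs⟩ := h σ (hσ.mono (introduced_child_subset (List.Subset.refl _))) hb
    simp only [Cond.toDL]
    exact ⟨by simpa [Goal.level] using hl, hs⟩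
  | .notIn es S, Γ, p, b, k => by
    intro hwf hnd hne
    rw [Cond.WF] at hwf
    simp only [Cond.declared] at hnd hne
    obtain ⟨N, hN, τ, h⟩ := S.exists_levels hg Γ (p ++ [0]) b hwf.2.1 hnd hne
    refine ⟨N + 1, Nat.le_add_right_of_le hN, τ, fun σ hσ hb guard _ => ?_⟩
    rw [Cond.declared] at hσ
    obtain ⟨hl, hs⟩ := h σ (hσ.mono (introduced_child_subset (List.Subset.refl _))) hb
    simp only [Cond.toDL]
    exact ⟨by simpa [Goal.level] using hl, hs⟩
  | .exist S, Γ, p, b, k => by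
    intro hwf hnd hne
    rw [Cond.WF] at hwf
    simp only [Cond.declared] at hnd hne
    obtain ⟨N, hN, τ₁, h⟩ := S.exists_levels hg Γ (p ++ [0]) b hwf hnd hne
    obtain ⟨τ, hτ⟩ := exists_glue τ₁ (fun _ => N)
      (disjoint_introduced_self (p := p) (i := 0) hg hne)
    refine ⟨N + 2, Nat.le_add_right_of_le hN, τ, fun σ hσ hb guard _ => ?_⟩
    rw [Cond.declared] at hσ
    obtain ⟨e₁, e₂⟩ := hτ σ _ hσ (introduced_child_subset (List.Subset.refl _))
      singleton_self_subset_introduced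
    have hgp : σ (g p) = N := e₂ rfl
    obtain ⟨hl, hs⟩ := h σ e₁ hb
    simp only [Cond.toDL]
    refine ⟨by simp [varGoal, Goal.level, hgp], hs.cons_plain ?_⟩
    simpa [Rule.body, Rule.head, varGoal, Goal.assumed, Goal.level, hgp] using hl
  | .and c₁ c₂, Γ, p, b, k => by
    intro hwf hnd hne
    rw [Cond.WF] at hwf
    simp only [Cond.declared, List.nodup_append', List.mem_append, or_imp, forall_and]
      at hnd hne
    obtain ⟨N₁, hN₁, τ₁, h₁⟩ := c₁.exists_levels hg Γ (p ++ [0]) b k hwf.1 hnd.1 hne.1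
    obtain ⟨N₂, hN₂, τ₂, h₂⟩ := c₂.exists_levels hg Γ (p ++ [1]) b k hwf.2 hnd.2.1 hne.2
    obtain ⟨τ, hτ⟩ := exists_glue τ₁ τ₂
      (disjoint_introduced (p := p) hg zero_ne_one hnd.2.2 hne.1 hne.2)
    refine ⟨max N₁ N₂, le_max_of_le_left hN₁, τ, fun σ hσ hb guard hgd => ?_⟩
    rw [Cond.declared] at hσ
    obtain ⟨e₁, e₂⟩ := hτ σ _ hσ (introduced_child_subset (List.subset_append_left _ _))
      (introduced_child_subset (List.subset_append_right _ _))
    obtain ⟨hl₁, hs₁⟩ := h₁ σ e₁ hb guard hgd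
    obtain ⟨hl₂, hs₂⟩ := h₂ σ e₂ hb guard hgd
    simp only [Cond.toDL]
    refine ⟨fun G hG => ?_, hs₁.append hs₂⟩
    rcases List.mem_append.1 hG with hG | hG
    · exact le_max_of_le_left (hl₁ G hG)
    · exact le_max_of_le_right (hl₂ G hG)
  | .or c₁ c₂, Γ, p, b, k => by
    intro hwf hnd hne
    rw [Cond.WF] at hwf
    simp only [Cond.declared, List.nodup_append', List.mem_append, or_imp, forall_and]
      at hnd hne
    obtain ⟨N₁, hN₁, τ₁, h₁⟩ := c₁.exists_levels hg Γ (p ++ [0]) b k hwf.1 hnd.1 hne.1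
    obtain ⟨N₂, hN₂, τ₂, h₂⟩ := c₂.exists_levels hg Γ (p ++ [1]) b k hwf.2 hnd.2.1 hne.2
    obtain ⟨τ₃, hτ₃⟩ := exists_glue τ₁ τ₂
      (disjoint_introduced (p := p) hg zero_ne_one hnd.2.2 hne.1 hne.2)
    obtain ⟨τ, hτ⟩ := exists_glue τ₃ (fun _ => max N₁ N₂) (Set.disjoint_union_left.2
      ⟨disjoint_introduced_self (p := p) (i := 0) hg hne.1,
        disjoint_introduced_self (p := p) (i := 1) hg hne.2⟩)
    refine ⟨max N₁ N₂ + 2, Nat.le_add_right_of_le (le_max_of_le_left hN₁), τ,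
      fun σ hσ hb guard hgd => ?_⟩
    rw [Cond.declared] at hσ
    obtain ⟨e, e₃⟩ := hτ σ _ hσ (Set.union_subset
      (introduced_child_subset (List.subset_append_left _ _))
      (introduced_child_subset (List.subset_append_right _ _))) singleton_self_subset_introduced
    obtain ⟨e₁, e₂⟩ := hτ₃ σ _ e Set.subset_union_left Set.subset_union_right
    have hgp : σ (g p) = max N₁ N₂ := e₃ rfl
    obtain ⟨hl₁, hs₁⟩ := h₁ σ e₁ hb guard hgd
    obtain ⟨hl₂, hs₂⟩ := h₂ σ e₂ hb guard hgd
    simp only [Cond.toDL]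
    refine ⟨by simp [varGoal, Goal.level, hgp],
      ((hs₁.append hs₂).cons_plain fun G hG => ?_).cons_plain fun G hG => ?_⟩
    · change _ ∧ _ ≤ σ (g p)
      rw [hgp]
      rcases List.mem_append.1 hG with hG | hG
      · exact ⟨(hgd G hG).1, le_max_of_le_left ((hgd G hG).2.trans hN₁)⟩
      · exact ⟨(c₂.isTest_toDL G hG).assumed_eq, le_max_of_le_right (hl₂ G hG)⟩
    · change _ ∧ _ ≤ σ (g p)
      rw [hgp]
      rcases List.mem_append.1 hG with hG | hG
      · exact ⟨(hgd G hG).1, le_max_of_le_left ((hgd G hG).2.trans hN₁)⟩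
      · exact ⟨(c₁.isTest_toDL G hG).assumed_eq, le_max_of_le_left (hl₁ G hG)⟩
  | .not c, Γ, p, b, k => by
    intro hwf hnd hne
    rw [Cond.WF] at hwf
    simp only [Cond.declared] at hnd hne
    obtain ⟨N, hN, τ₁, h⟩ := c.exists_levels hg Γ (p ++ [0]) b k hwf hnd hne
    obtain ⟨τ, hτ⟩ := exists_glue τ₁ (fun _ => N)
      (disjoint_introduced_self (p := p) (i := 0) hg hne)
    refine ⟨N + 1, Nat.le_add_right_of_le hN, τ, fun σ hσ hb guard hgd => ?_⟩
    rw [Cond.declared] at hσ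
    obtain ⟨e₁, e₂⟩ := hτ σ _ hσ (introduced_child_subset (List.Subset.refl _))
      singleton_self_subset_introduced
    have hgp : σ (g p) = N := e₂ rfl
    obtain ⟨hl, hs⟩ := h σ e₁ hb guard hgd
    simp only [Cond.toDL]
    refine ⟨by simp [varGoal, Goal.level, hgp], hs.cons_plain fun G hG => ?_⟩
    change _ ∧ _ ≤ σ (g p)
    rw [hgp]
    rcases List.mem_append.1 hG with hG | hG
    · exact ⟨(hgd G hG).1, (hgd G hG).2.trans hN⟩
    · exact ⟨(c.isTest_toDL G hG).assumed_eq, hl G hG⟩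

theorem Views.exists_levels (hg : Function.Injective g) :
    ∀ (vs : Views Name Val) (Γ : Scope Name) (p : List ℕ) (b : ℕ), vs.WF Γ →
      (vs.names ++ vs.declared).Nodup → (∀ x ∈ vs.names ++ vs.declared, ∀ q, x ≠ g q) →
      ∃ N ≥ b, ∃ τ : Name → ℕ, ∀ σ : Name → ℕ,
        Set.EqOn σ τ (introduced g p (vs.names ++ vs.declared)) →
        (∀ T, (Γ T).isSome → σ T ≤ b) → (∀ x ∈ vs.names, σ x ≤ N) ∧
          IsStratification σ (vs.toDL g Γ p : Program Name Val)
  | .nil, Γ, p, b => by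
    intro _ _ _
    refine ⟨b, le_rfl, 0, fun σ _ hb => ?_⟩
    rw [Views.toDL]
    exact ⟨by simp [Views.names], isStratification_zero⟩
  | .cons r Q vs, Γ, p, b => by
    intro hwf hnd hne
    rw [Views.WF] at hwf
    rw [Views.names, Views.declared] at hnd hne
    have hsub₁ : Q.declared ⊆ (r :: vs.names) ++ (Q.declared ++ vs.declared) :=
      fun x hx => by simp [hx]
    have hsub₂ : vs.names ++ vs.declared ⊆ (r :: vs.names) ++ (Q.declared ++ vs.declared) :=
      fun x hx => by
        simp only [List.mem_append, List.mem_cons] at hx ⊢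
        tauto
    have hr : r ∈ (r :: vs.names) ++ (Q.declared ++ vs.declared) := by simp
    have hne₁ := fun x hx => hne x (hsub₁ hx)
    have hne₂ := fun x hx => hne x (hsub₂ hx)
    simp only [List.nodup_append', List.nodup_cons, List.disjoint_append_right,
      List.disjoint_cons_left] at hnd
    obtain ⟨⟨hrn, hn⟩, ⟨hdQ, hdv, hdQv⟩, ⟨hrQ, hnQ⟩, hrv, hnv⟩ := hnd
    obtain ⟨N₁, hN₁, τ₁, h₁⟩ := Q.exists_levels hg Γ (p ++ [0]) b hwf.1 hdQ hne₁
    obtain ⟨N₂, hN₂, τ₂, h₂⟩ := vs.exists_levels hg Γ (p ++ [1]) N₁ hwf.2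
      (List.nodup_append'.2 ⟨hn, hdv, hnv⟩) hne₂
    obtain ⟨τ₃, hτ₃⟩ := exists_glue τ₁ τ₂ (disjoint_introduced (p := p) hg zero_ne_one
      (List.disjoint_append_right.2 ⟨hnQ.symm, hdQv⟩) hne₁ hne₂)
    obtain ⟨τ, hτ⟩ := exists_glue (S₂ := {r}) τ₃ (fun _ => N₁) (Set.disjoint_union_left.2
      ⟨(Set.disjoint_singleton_right (s := introduced g (p ++ [0]) Q.declared)).2 (by
        rintro (⟨q, -, hq⟩ | h)
        exacts [hne r hr q hq, hrQ h]),
      (Set.disjoint_singleton_right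
        (s := introduced g (p ++ [1]) (vs.names ++ vs.declared))).2 (by
        rintro (⟨q, -, hq⟩ | h)
        exacts [hne r hr q hq, (List.mem_append.1 h).elim hrn hrv])⟩)
    refine ⟨N₂, hN₁.le.trans hN₂, τ, fun σ hσ hb => ?_⟩
    rw [Views.names, Views.declared] at hσ
    obtain ⟨e, e₃⟩ := hτ σ _ hσ (Set.union_subset (introduced_child_subset hsub₁)
      (introduced_child_subset hsub₂)) (Set.singleton_subset_iff.2 (.inr hr))
    obtain ⟨e₁, e₂⟩ := hτ₃ σ _ e Set.subset_union_left Set.subset_union_right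
    have hσr : σ r = N₁ := e₃ rfl
    obtain ⟨hl, hs⟩ := h₂ σ e₂ fun T hT => (hb T hT).trans hN₁
    rw [Views.toDL, Views.names]
    refine ⟨fun x hx => ?_, (h₁ σ e₁ hb r hσr.ge).append hs⟩
    rcases List.mem_cons.1 hx with rfl | hx
    · exact hσr.le.trans hN₂
    · exact hl x hx

end

theorem exists_isStratification {Δ : Database Name Val} {r : Name} {Q : Query Name Val}
    (hQ : Q.WF Δ.scope) (hr : r ∉ Δ.tables) (hrQ : r ∉ Q.declared)
    (hg : IsFreshSupply g Δ r Q) (hnd : Q.declared.Nodup) :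
    ∃ σ : Name → ℕ, IsStratification σ (Δ.facts + sqlToDL g Δ r Q) := by
  obtain ⟨hinj, hfresh⟩ := hg
  obtain ⟨N, -, τ₁, h⟩ := Q.exists_levels hinj Δ.scope [] 0 hQ hnd
    (by rintro x hx q rfl; exact (hfresh q).2.2 hx)
  have hri : r ∉ introduced g [] Q.declared := by
    rintro (⟨q, -, rfl⟩ | h)
    exacts [(hfresh q).2.1 rfl, hrQ h]
  have hdis : Disjoint (introduced g [] Q.declared ∪ {r}) {T | T ∈ Δ.tables} := by
    rw [Set.disjoint_right]
    rintro T hT ((⟨q, -, rfl⟩ | h) | h)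
    · exact (hfresh q).1 hT
    · have := Q.scope_declared hQ h
      simp [Database.scope, show T ∈ Δ.tables from hT] at this
    · exact hr (Set.mem_singleton_iff.1 h ▸ hT)
  obtain ⟨τ₂, hτ₂⟩ := exists_glue τ₁ (fun _ => N) (Set.disjoint_singleton_right.2 hri)
  obtain ⟨σ, hσ⟩ := exists_glue τ₂ (fun _ => 0) hdis
  obtain ⟨e, e₃⟩ := hσ σ _ (Set.eqOn_refl σ Set.univ) (Set.subset_univ _) (Set.subset_univ _)
  obtain ⟨e₁, e₂⟩ := hτ₂ σ _ e Set.subset_union_left Set.subset_union_right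
  refine ⟨σ, Δ.isStratification_facts.add (h σ e₁ (fun T hT => ?_) r (e₂ rfl).ge)⟩
  refine (e₃ ?_).le
  by_contra hT'
  have hT'' : T ∉ Δ.tables := hT'
  simp [Database.scope, hT''] at hT

end Stratification

end HypSQL

theorem mainTheorem1 {Name : Type*} {Val : Type*} [DecidableEq Name] [Inhabited Val]
    [LinearOrder Val]
    (ans : Database Name Val → Query Name Val → Multiset (List Val))
    (hans : IsCorrectImplementation ans)
    (Δ : Database Name Val) (r : Name) (Q : Query Name Val) (g : List ℕ → Name)
    (hQ : Q.WF Δ.scope) (hr : r ∉ Δ.tables) (hrQ : r ∉ Q.declared)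
    (hg : IsFreshSupply g Δ r Q) :
    (∀ σ : Name → ℕ, IsStratification σ (Δ.facts + sqlToDL g Δ r Q) →
      meaningIn (Δ.facts + sqlToDL g Δ r Q)
          (solve (varGoal r 0 Q.degree) (unifiedSemantics (Δ.facts + sqlToDL g Δ r Q) σ)) =
        countFun ((ans Δ Q).map fun t => .atom (factAtom r t))) ∧
    (Q.declared.Nodup → ∃ σ : Name → ℕ, IsStratification σ (Δ.facts + sqlToDL g Δ r Q)) := by
  constructor
  · intro σ hσ
    rw [hans Δ Q hQ]
    exact meaningIn_solve_eq_countFun hQ hr hrQ hg hσ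
  · exact exists_isStratification hQ hr hrQ hg
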